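/- Let $n>0$ be an integer. A partition of $n$ is a weakly decreasing sequence of positive integers with sum $n$. Let $\lambda=(\lambda_1,\dotsc,\lambda_r)$ and $\mu=(\mu_1,\dotsc,\mu_s)$ be partitions of $n$ such that $$\lambda_1+\cdots+\lambda_i\le\mu_1+\cdots+\mu_i\qquad\text{for all } i\ge 1,$$ where $\lambda_i=0$ for $i>r$ and $\mu_i=0$ for $i>s$. Let $A$ be a real $n\times n$ matrix that is totally nonnegative, i.e. every minor (determinant of a square submatrix) of $A$ is nonnegative. Then $$\lambda_1!\cdots\lambda_r!\sum_{(I_1,\dotsc,I_r)}\det(A_{I_1,I_1})\cdots\det(A_{I_r,I_r})\;\ge\;\mu_1!\cdots\mu_s!\sum_{(J_1,\dotsc,J_s)}\det(A_{J_1,J_1})\cdots\det(A_{J_s,J_s}),$$ where the first sum is over all sequences $(I_1,\dotsc,I_r)$ of pairwise disjoint subsets of $\{1,\dotsc,n\}$ with $|I_k|=\lambda_k$ for all $k$, the second sum is over all sequences $(J_1,\dotsc,J_s)$ of pairwise disjoint subsets of $\{1,\dotsc,n\}$ with $|J_k|=\mu_k$ for all $k$, and $A_{I,I}$ denotes the submatrix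 of $A$ with rows and columns indexed by $I$. -/

import Mathlib

namespace BarrettJohnson

/-- The parts of a partition of `n`, listed in weakly decreasing order: `[p₁, …, p_r]`
with `p₁ ≥ ⋯ ≥ p_r > 0`. -/
def partSeq {n : ℕ} (p : n.Partition) : List ℕ :=
  p.parts.sort (· ≥ ·)

/-- The majorization order on partitions of `n`: `p ⪯ q` iff
`p₁ + ⋯ + p_i ≤ q₁ + ⋯ + q_i` for all `i`, parts beyond the last one being counted as `0`
(`List.take i` returns the whole list when `i` exceeds its length). -/
def MajorizedBy {n : ℕ} (p q : n.Partition) : Prop :=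
  ∀ i : ℕ, ((partSeq p).take i).sum ≤ ((partSeq q).take i).sum

/-- A real square matrix is totally nonnegative if all its minors are nonnegative. A minor is
given by a choice of `k` rows and `k` columns, each listed in increasing order. -/
def TotallyNonneg {n : ℕ} (A : Matrix (Fin n) (Fin n) ℝ) : Prop :=
  ∀ (k : ℕ) (rows cols : Fin k ↪o Fin n), 0 ≤ (A.submatrix rows cols).det

/-- The principal minor `det (A_{I,I})`; it equals `1` for `I = ∅`. -/
def principalMinor {n : ℕ} (A : Matrix (Fin n) (Fin n) ℝ) (I : Finset (Fin n)) : ℝ :=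
  (A.submatrix (fun i : I => (i : Fin n)) (fun i : I => (i : Fin n))).det

/-- For `l = [l₁, …, l_r]`, the sequences `(I₁, …, I_r)` of pairwise disjoint subsets of an
`n`-element set with `|I_k| = l_k` for all `k`. If the `l_k` sum to `n`, these are the ordered set
partitions of type `l`. -/
def orderedSetPartitions (n : ℕ) (l : List ℕ) : Finset (Fin l.length → Finset (Fin n)) :=
  {I | (∀ k, (I k).card = l.get k) ∧ ∀ j k, j ≠ k → Disjoint (I j) (I k)}

/-- The sum of `det (A_{I₁,I₁}) ⋯ det (A_{I_r,I_r})` over the ordered set partitions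
`(I₁, …, I_r)` whose type is the partition `p`. -/
def minorProductSum {n : ℕ} (A : Matrix (Fin n) (Fin n) ℝ) (p : n.Partition) : ℝ :=
  ∑ I ∈ orderedSetPartitions n (partSeq p), ∏ k, principalMinor A (I k)

/-- The product `p₁! ⋯ p_r!`. -/
def factorialProduct {n : ℕ} (p : n.Partition) : ℕ :=
  ((partSeq p).map Nat.factorial).prod

end BarrettJohnson

/-!
The averages of products of principal minors are compared by moving one unit at a time between two
blocks. If `mu` majorizes `lam`, then `mu` is carried to `lam` by transfers of a unit from a larger
part to a smaller one (`exists_transfer`), and it suffices that one transfer does not decrease the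
weighted sum. Grouping the set partitions by the union `T` of the two blocks concerned
(`sum_disjointFamilies`) reduces this to two blocks: with `m = T.card`, the sum `f k` of
`det A[X, X] * det A[T \ X, T \ X]` over the `k`-subsets `X` of `T` has to satisfy
`(m - k) * f k ≤ (k + 1) * f (k + 1)` for `2 * (k + 1) ≤ m`
(`TotallyNonneg.normalizedMonotone`).

Products of two minors of a totally nonnegative matrix are governed by planar diagrams. Such a
matrix is a product of nonnegative diagonal and elementary bidiagonal matrices
(`TotallyNonneg.elementaryProduct`, by Neville elimination). A pair of index sets `(I, J)` is
viewed as a configuration of sites, each occupied at most twice, in which singly occupied sites are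
colored by the set they belong to. An elementary bidiagonal factor moves indices between adjacent sites, and on
the words of colors it acts by identity strands, cups and caps with nonnegative coefficients
(`HasPlanarKernels.rowAdd`). Hence `det A[I, I'] * det A[J, J']` is, for fixed occupancies, a
nonnegative combination of Temperley–Lieb diagrams with loop value `2`.

Finally `f k` is the trace of such a combination on the words with `k` letters of the first color.
The identity diagram has trace `m.choose k`, for which the inequality is an equality; any other diagram
has a cup, which by cyclicity of the trace can be carried around to the other side, giving a diagram
on `m - 2` strands with `k` lowered by one (`wordTrace_cupLeft`). The inequality survives that shift
(`NormalizedMonotone.shift`), so it holds for all diagrams by induction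
(`TemperleyLieb.normalizedMonotone_wordTrace`).
-/

namespace BarrettJohnson

/-! ### The three-term Plücker relation and the elimination inequality -/

section

open Matrix Function

/-- Two indices of `Fin n` that differ by exactly one, in either order. -/
def Consecutive {n : ℕ} (i j : Fin n) : Prop :=
  i.val + 1 = j.val ∨ j.val + 1 = i.val

/-- The matrices obtained from the identity by nonnegative scalings of rows and columns (the factor
`0` is allowed), and by adding nonnegative multiples of rows (columns) to adjacent rows (columns).
These are the products of nonnegative diagonal matrices and nonnegative elementary bidiagonal
matrices; column operations are row operations conjugated by `transpose`. -/
inductive ElementaryProduct {n : ℕ} : Matrix (Fin n) (Fin n) ℝ → Prop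
  | one : ElementaryProduct 1
  | rowAdd {A : Matrix (Fin n) (Fin n) ℝ} (i j : Fin n) (hij : Consecutive i j) (c : ℝ)
      (hc : 0 ≤ c) (hA : ElementaryProduct A) :
      ElementaryProduct (A.updateRow i (A i + c • A j))
  | rowScale {A : Matrix (Fin n) (Fin n) ℝ} (i : Fin n) (c : ℝ) (hc : 0 ≤ c)
      (hA : ElementaryProduct A) : ElementaryProduct (A.updateRow i (c • A i))
  | transpose {A : Matrix (Fin n) (Fin n) ℝ} (hA : ElementaryProduct A) :
      ElementaryProduct Aᵀ

lemma Consecutive.ne {n : ℕ} {i j : Fin n} (h : Consecutive i j) : i ≠ j := by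
  rintro rfl; rcases h with h | h <;> omega

lemma strictMono_update_of_consecutive {k n : ℕ} {r : Fin k → Fin n} (hr : StrictMono r)
    {s : Fin k} {j : Fin n} (h : Consecutive (r s) j) (hj : ∀ a, r a ≠ j) :
    StrictMono (update r s j) := by
  intro a b hab
  have h1 := hr hab
  have ha := hj a
  have hb := hj b
  simp only [update_apply]
  split_ifs with h2 h3 h3
  · subst h2; subst h3; exact absurd hab (lt_irrefl _)
  · subst h2; rcases h with h | h <;> (rw [Fin.lt_def] at *; rw [Ne, Fin.ext_iff] at hb; omega)
  · subst h3; rcases h with h | h <;> (rw [Fin.lt_def] at *; rw [Ne, Fin.ext_iff] at ha; omega)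
  · exact h1

lemma TotallyNonneg.det_nonneg {n k : ℕ} {A : Matrix (Fin n) (Fin n) ℝ} (hA : TotallyNonneg A)
    {r c : Fin k → Fin n} (hr : StrictMono r) (hc : StrictMono c) :
    0 ≤ (A.submatrix r c).det :=
  hA k (OrderEmbedding.ofStrictMono r hr) (OrderEmbedding.ofStrictMono c hc)

lemma TotallyNonneg.transpose {n : ℕ} {A : Matrix (Fin n) (Fin n) ℝ} (hA : TotallyNonneg A) :
    TotallyNonneg Aᵀ := by
  intro k r c
  rw [← det_transpose, transpose_submatrix, transpose_transpose]
  exact hA k c r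

lemma TotallyNonneg.nonneg {n : ℕ} {A : Matrix (Fin n) (Fin n) ℝ} (hA : TotallyNonneg A)
    (i j : Fin n) : 0 ≤ A i j := by
  have := hA.det_nonneg (k := 1) (r := fun _ => i) (c := fun _ => j)
    (Subsingleton.strictMono _) (Subsingleton.strictMono _)
  simpa using this

lemma TotallyNonneg.mul_le_mul {n : ℕ} {A : Matrix (Fin n) (Fin n) ℝ} (hA : TotallyNonneg A)
    {i i' j j' : Fin n} (hi : i < i') (hj : j < j') : A i j' * A i' j ≤ A i j * A i' j' := by
  have := hA.det_nonneg (k := 2) (r := ![i, i']) (c := ![j, j'])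
    (by intro a b hab; fin_cases a <;> fin_cases b <;> simp_all)
    (by intro a b hab; fin_cases a <;> fin_cases b <;> simp_all)
  rw [det_fin_two] at this
  simp at this
  linarith

section Submatrix

variable {m n k : ℕ} (A : Matrix (Fin m) (Fin n) ℝ) (r : Fin k → Fin m) (c : Fin k → Fin n)

lemma submatrix_update (s : Fin k) (j : Fin m) :
    A.submatrix (update r s j) c = (A.submatrix r c).updateRow s (A j ∘ c) := by
  ext a b
  by_cases h : a = s
  · subst h; simp
  · simp [h, updateRow_ne]

lemma updateRow_submatrix_of_injective (hr : Injective r) (s : Fin k) (v : Fin n → ℝ) :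
    (A.updateRow (r s) v).submatrix r c = (A.submatrix r c).updateRow s (v ∘ c) := by
  ext a b
  by_cases h : a = s
  · subst h; simp
  · simp [h, updateRow_ne, hr.ne h]

lemma updateRow_submatrix_of_notMem (i : Fin m) (hi : ∀ a, r a ≠ i) (v : Fin n → ℝ) :
    (A.updateRow i v).submatrix r c = A.submatrix r c := by
  ext a b
  simp [updateRow_ne, hi a]

lemma det_updateRow_add_smul_submatrix (hr : Injective r) (s : Fin k) (j : Fin m) (x : ℝ) :
    ((A.updateRow (r s) (A (r s) + x • A j)).submatrix r c).det =
      (A.submatrix r c).det + x * (A.submatrix (update r s j) c).det := by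
  rw [updateRow_submatrix_of_injective A r c hr, submatrix_update,
    show (A (r s) + x • A j) ∘ c = A (r s) ∘ c + x • (A j ∘ c) from rfl, det_updateRow_add,
    det_updateRow_smul]
  congr 2
  exact updateRow_eq_self (A.submatrix r c) s

lemma det_submatrix_update_eq_zero {s a : Fin k} (h : a ≠ s) :
    (A.submatrix (update r s (r a)) c).det = 0 := by
  refine det_zero_of_row_eq h ?_
  ext b
  simp [h]

end Submatrix

lemma TotallyNonneg.rowAdd {n : ℕ} {A : Matrix (Fin n) (Fin n) ℝ} (hA : TotallyNonneg A)
    {i j : Fin n} (hij : Consecutive i j) {x : ℝ} (hx : 0 ≤ x) :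
    TotallyNonneg (A.updateRow i (A i + x • A j)) := by
  intro k r c
  by_cases hi : ∃ s, r s = i
  · obtain ⟨s, rfl⟩ := hi
    rw [det_updateRow_add_smul_submatrix A r c r.injective]
    refine add_nonneg (hA k r c) (mul_nonneg hx ?_)
    by_cases hj : ∃ a, r a = j
    · obtain ⟨a, rfl⟩ := hj
      rw [det_submatrix_update_eq_zero]
      rintro rfl
      exact hij.ne rfl
    · push Not at hj
      exact hA.det_nonneg (strictMono_update_of_consecutive r.strictMono hij hj) c.strictMono
  · push Not at hi
    rw [updateRow_submatrix_of_notMem A r c i hi]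
    exact hA k r c

lemma det_updateRow_sum_smul {k : ℕ} {ι : Type*} [Fintype ι] (N : Matrix (Fin k) (Fin k) ℝ)
    (u : Fin k) (a : ι → ℝ) (f : ι → Fin k → ℝ) :
    (N.updateRow u (∑ l, a l • f l)).det = ∑ l, a l * (N.updateRow u (f l)).det := by
  have := map_sum ((detRowAlternating (R := ℝ) (n := Fin k)).toMultilinearMap.toLinearMap N u)
    (fun l => a l • f l) Finset.univ
  simp only [map_smul, smul_eq_mul] at this
  exact this

/-- Moving row `t` to position `s` and filling the gap with `w` is, up to one transposition of
rows, the same as writing `w` at position `s`. -/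
lemma det_updateRow_row_updateRow {k : ℕ} (M : Matrix (Fin k) (Fin k) ℝ) {s t : Fin k}
    (hst : s ≠ t) (w : Fin k → ℝ) :
    ((M.updateRow s (M t)).updateRow t w).det = -(M.updateRow s w).det := by
  have h : (M.updateRow s (M t)).updateRow t w =
      (M.updateRow s w).submatrix (Equiv.swap s t) id := by
    ext a b
    by_cases h1 : a = t
    · subst h1; simp
    · by_cases h2 : a = s
      · subst h2; simp [updateRow_ne, hst, hst.symm]
      · simp [updateRow_ne, h1, h2, Equiv.swap_apply_of_ne_of_ne h2 h1]
  rw [h, det_permute, Equiv.Perm.sign_swap hst]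
  simp

/-- The three-term Plücker relation, for the determinants obtained from `M` by replacing rows `s`
and `t` by `v` and `w`. Both sides are linear in `v`, and the rows of the invertible matrix `M`
span, so it suffices to take for `v` a row of `M`. -/
lemma det_mul_det_updateRow_updateRow {k : ℕ} (M : Matrix (Fin k) (Fin k) ℝ) (hM : M.det ≠ 0)
    {s t : Fin k} (hst : s ≠ t) (v w : Fin k → ℝ) :
    M.det * ((M.updateRow s v).updateRow t w).det =
      (M.updateRow s v).det * (M.updateRow t w).det -
        (M.updateRow s w).det * (M.updateRow t v).det := by
  obtain ⟨a, rfl⟩ : ∃ a : Fin k → ℝ, v = ∑ l, a l • M.row l := by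
    refine ⟨v ᵥ* M⁻¹, ?_⟩
    have h : (v ᵥ* M⁻¹) ᵥ* M = v := by
      rw [vecMul_vecMul, nonsing_inv_mul _ (isUnit_iff_ne_zero.2 hM), vecMul_one]
    exact h.symm.trans (vecMul_eq_sum _ _)
  rw [updateRow_comm M hst, det_updateRow_sum_smul, det_updateRow_sum_smul,
    det_updateRow_sum_smul, Finset.mul_sum, Finset.sum_mul, Finset.mul_sum,
    ← Finset.sum_sub_distrib]
  refine Finset.sum_congr rfl fun l _ => ?_
  rw [updateRow_comm M hst.symm, show M.row l = M l from rfl]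
  by_cases hs : l = s
  · subst hs
    rw [updateRow_eq_self, det_updateRow_eq_zero hst]
    ring
  by_cases ht : l = t
  · subst ht
    rw [updateRow_eq_self, det_updateRow_eq_zero hst.symm, det_updateRow_row_updateRow M hst]
    ring
  · rw [det_updateRow_eq_zero hs, det_updateRow_eq_zero ht,
      updateRow_comm M hst]
    have : ((M.updateRow t w).updateRow s (M l)).det = 0 := by
      refine det_zero_of_row_eq (Ne.symm hs) ?_
      rw [updateRow_self, updateRow_ne hs, updateRow_ne ht]
    rw [this]
    ring

lemma strictMono_update_of_lt {k n : ℕ} {r : Fin k → Fin n} (hr : StrictMono r) {t : Fin k}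
    {i : Fin n} (h1 : r t < i) (h2 : ∀ a, t < a → i < r a) : StrictMono (update r t i) := by
  intro a b hab
  simp only [update_apply]
  split_ifs with ha hb hb
  · subst ha; subst hb; exact absurd hab (lt_irrefl _)
  · subst ha; exact h2 b hab
  · subst hb; exact (hr hab).trans h1
  · exact hr hab

lemma det_eq_mul_of_column_zero {k : ℕ} (N : Matrix (Fin (k + 1)) (Fin (k + 1)) ℝ)
    (h : ∀ a : Fin k, N a.succ 0 = 0) :
    N.det = N 0 0 * (N.submatrix Fin.succ Fin.succ).det := by
  rw [det_succ_column_zero, Fin.sum_univ_succ]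
  simp [h]

/-- The case of `TotallyNonneg.mul_det_update_le` in which `j` is the first of the selected rows.
If the selected columns omit column `0`, the difference of the two sides is the minor with row `i`
and column `0` added, expanded along column `0`; otherwise both sides agree. -/
lemma TotallyNonneg.mul_det_update_le_of_zero {n k : ℕ}
    {A : Matrix (Fin (n + 1)) (Fin (n + 1)) ℝ} (hA : TotallyNonneg A) {i j : Fin (n + 1)}
    (hij : i.val + 1 = j.val) (hz : ∀ l, j < l → A l 0 = 0) {r c : Fin (k + 1) → Fin (n + 1)}
    (hr : StrictMono r) (hc : StrictMono c) (hj : r 0 = j) :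
    A j 0 * (A.submatrix (update r 0 i) c).det ≤ A i 0 * (A.submatrix r c).det := by
  have hlt : ∀ a : Fin k, j < r a.succ := fun a => hj ▸ hr (Fin.succ_pos a)
  have hz' : ∀ a : Fin k, A (r a.succ) 0 = 0 := fun a => hz _ (hlt a)
  by_cases hc0 : c 0 = 0
  · rw [det_eq_mul_of_column_zero (A.submatrix r c) (by simp [hc0, hz']),
      det_eq_mul_of_column_zero (A.submatrix (update r 0 i) c) (by simp [hc0, hz'])]
    have : ((A.submatrix (update r 0 i) c).submatrix Fin.succ Fin.succ) =
        ((A.submatrix r c).submatrix Fin.succ Fin.succ) := by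
      ext a b
      simp
    rw [this]
    simp only [submatrix_apply, update_self, hj, hc0]
    exact le_of_eq (by ring)
  · have hr' : StrictMono (Fin.cons i r : Fin (k + 2) → Fin (n + 1)) := by
      rw [Fin.strictMono_iff_lt_succ]
      intro a
      refine Fin.cases ?_ (fun a => ?_) a
      · simp only [Fin.castSucc_zero, Fin.cons_zero, Fin.cons_succ, hj]
        rw [Fin.lt_def]; omega
      · rw [← Fin.succ_castSucc, Fin.cons_succ, Fin.cons_succ]
        exact hr (Fin.castSucc_lt_succ)
    have hc' : StrictMono (Fin.cons 0 c : Fin (k + 2) → Fin (n + 1)) := by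
      rw [Fin.strictMono_iff_lt_succ]
      intro a
      refine Fin.cases ?_ (fun a => ?_) a
      · simp only [Fin.castSucc_zero, Fin.cons_zero, Fin.cons_succ]
        exact Fin.pos_of_ne_zero hc0
      · rw [← Fin.succ_castSucc, Fin.cons_succ, Fin.cons_succ]
        exact hc (Fin.castSucc_lt_succ)
    have h := hA.det_nonneg hr' hc'
    rw [det_succ_column_zero, Fin.sum_univ_succ, Fin.sum_univ_succ] at h
    have e1 : ((A.submatrix (Fin.cons i r : Fin (k + 2) → Fin (n + 1)) (Fin.cons 0 c)).submatrix
        (Fin.succAbove 0) Fin.succ) = A.submatrix r c := by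
      ext a b; simp
    have e2 : ((A.submatrix (Fin.cons i r : Fin (k + 2) → Fin (n + 1)) (Fin.cons 0 c)).submatrix
        (Fin.succAbove (Fin.succ 0)) Fin.succ) = A.submatrix (update r 0 i) c := by
      ext a b
      refine Fin.cases ?_ (fun a => ?_) a
      · simp
      · simp
    rw [e1, e2] at h
    simp [hz', hj] at h
    linarith

/-- If column `0` of a totally nonnegative matrix vanishes below row `j = i + 1`, then for every
minor that uses row `j` but not row `i`, the quotient of it by the minor with `i` in place of `j` is
at least `A j 0 / A i 0`. This is what makes the elimination step `TotallyNonneg.rowSub` preserve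
total nonnegativity. Induction on the number of selected rows above `j`: the Plücker relation with a
coordinate vector `e_q` compares the quotient with that of the minor from which column `q` and
the selected row preceding `j` are deleted. -/
lemma TotallyNonneg.mul_det_update_le {n : ℕ}
    {A : Matrix (Fin (n + 1)) (Fin (n + 1)) ℝ} (hA : TotallyNonneg A) {i j : Fin (n + 1)}
    (hij : i.val + 1 = j.val) (hz : ∀ l, j < l → A l 0 = 0) {k : ℕ}
    {r c : Fin k → Fin (n + 1)} (hr : StrictMono r) (hc : StrictMono c) {s : Fin k}
    (hs : r s = j) (hi : ∀ a, r a ≠ i) :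
    A j 0 * (A.submatrix (update r s i) c).det ≤ A i 0 * (A.submatrix r c).det := by
  induction k with
  | zero => exact s.elim0
  | succ k ih =>
  rcases Fin.eq_zero_or_eq_succ s with rfl | ⟨t, rfl⟩
  · exact hA.mul_det_update_le_of_zero hij hz hr hc hs
  set t' : Fin (k + 1) := t.castSucc with ht'
  have hts : t.succ ≠ t' := (Fin.castSucc_lt_succ).ne'
  have hcons : Consecutive (r t.succ) i := Or.inr (by rw [hs, hij])
  have hmono := strictMono_update_of_consecutive hr hcons hi
  set M := A.submatrix (update r t.succ i) c with hM
  have hM0 : 0 ≤ M.det := hA.det_nonneg hmono hc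
  have hdet0 := hA.det_nonneg hr hc
  rcases hM0.eq_or_lt with hM0 | hM0
  · rw [← hM0, mul_zero]
    exact mul_nonneg (hA.nonneg _ _) hdet0
  -- Some cofactor along row `t'` is nonzero; the corresponding column `q` is the one to delete, so
  -- that the quotient of smaller minors has a positive denominator.
  obtain ⟨q, hq⟩ : ∃ q, M.adjugate q t' ≠ 0 := by
    by_contra! h
    rw [det_eq_sum_mul_adjugate_row M t'] at hM0
    simp [h] at hM0
  obtain ⟨k, rfl⟩ : ∃ k', k = k' + 1 := ⟨k - 1, by have := t.2; omega⟩
  set r' := r ∘ t'.succAbove with hr'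
  set c' := c ∘ q.succAbove with hc'
  have hr'm : StrictMono r' := hr.comp (Fin.strictMono_succAbove t')
  have hc'm : StrictMono c' := hc.comp (Fin.strictMono_succAbove q)
  have ht't : t'.succAbove t = t.succ := Fin.succAbove_castSucc_self t
  have hr't : r' t = j := by simp [hr', ht't, hs]
  have hIH := ih hr'm hc'm (s := t) hr't (fun a => hi _)
  have hcons' : Consecutive (r' t) i := Or.inr (by rw [hr't, hij])
  have hx0 : 0 ≤ (A.submatrix (update r' t i) c').det :=
    hA.det_nonneg (strictMono_update_of_consecutive hr'm hcons' (fun a => hi _)) hc'm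
  set x := (A.submatrix (update r' t i) c').det with hx
  set y := (A.submatrix r' c').det with hy
  set ε : ℝ := (-1) ^ (t'.val + q.val) with hε
  have hε2 : ε * ε = 1 := by rw [hε, ← pow_add, ← two_mul]; simp
  have hrt : r t' < i := by
    have h1 : r t' < r t.succ := hr Fin.castSucc_lt_succ
    have h2 := hi t'
    rw [hs, Fin.lt_def] at h1
    rw [Ne, Fin.ext_iff] at h2
    rw [Fin.lt_def]
    omega
  have hz0 : 0 ≤ (A.submatrix (update r t' i) c).det := by
    refine hA.det_nonneg (strictMono_update_of_lt hr hrt fun a ha => ?_) hc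
    have h1 : r t.succ ≤ r a := hr.monotone (Fin.castSucc_lt_iff_succ_le.1 ha)
    rw [hs, Fin.le_def] at h1
    rw [Fin.lt_def]
    omega
  have hz'0 : 0 ≤ (A.submatrix (r ∘ t.succ.succAbove) c').det :=
    hA.det_nonneg (hr.comp (Fin.strictMono_succAbove _)) hc'm
  have hadj : ∀ (R : Fin (k + 1 + 1) → Fin (n + 1)) (u : Fin (k + 1 + 1)),
      ((A.submatrix R c).updateRow u (Pi.single q 1)).det =
        (-1) ^ (u.val + q.val) * (A.submatrix (R ∘ u.succAbove) c').det := by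
    intro R u
    rw [← adjugate_apply, adjugate_fin_succ_eq_det_submatrix, submatrix_submatrix]
  have hxeq : (M.updateRow t' (Pi.single q 1)).det = ε * x := by
    rw [hM, hadj, hx]
    congr 4
    rw [hr', ← ht't]
    exact (update_comp_eq_of_injective r Fin.succAbove_right_injective t i)
  have hxpos : 0 < x := by
    refine lt_of_le_of_ne hx0 fun h => hq ?_
    rw [adjugate_apply, hxeq, ← h, mul_zero]
  have hMv : M.updateRow t.succ (A j ∘ c) = A.submatrix r c := by
    rw [hM, ← submatrix_update, update_idem, ← hs, update_eq_self]
  have hyeq : ((A.submatrix r c).updateRow t' (Pi.single q 1)).det = ε * y := hadj r t'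
  have hz'eq : (M.updateRow t.succ (Pi.single q 1)).det =
      -(ε * (A.submatrix (r ∘ t.succ.succAbove) c').det) := by
    rw [hM, hadj]
    have h1 : update r t.succ i ∘ t.succ.succAbove = r ∘ t.succ.succAbove := by
      ext a; simp [Fin.succAbove_ne]
    have h2 : t.succ.val + q.val = (t'.val + q.val) + 1 := by simp [ht']; omega
    rw [h1, h2, pow_succ, ← hε]
    ring
  have hzeq : (M.updateRow t' (A j ∘ c)).det = -(A.submatrix (update r t' i) c).det := by
    have h1 : M.updateRow t' (A j ∘ c) =
        (A.submatrix (update r t' i) c).submatrix (Equiv.swap t.succ t') id := by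
      rw [hM, ← submatrix_update, submatrix_submatrix]
      congr 1
      ext1 a
      by_cases ha : a = t'
      · subst ha; simp [hts, hs]
      · by_cases ha' : a = t.succ
        · subst ha'; simp [hts]
        · simp [ha, ha', Equiv.swap_apply_of_ne_of_ne ha' ha]
    rw [h1, det_permute, Equiv.Perm.sign_swap hts]
    simp
  have key := det_mul_det_updateRow_updateRow M hM0.ne' hts (A j ∘ c) (Pi.single q 1)
  rw [hMv, hxeq, hyeq, hz'eq, hzeq] at key
  set D := (A.submatrix r c).det
  set z := (A.submatrix (update r t' i) c).det
  set z' := (A.submatrix (r ∘ t.succ.succAbove) c').det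
  -- The sign `ε` of the position `(t', q)` occurs once in each term of the relation.
  have key2 : M.det * y = D * x - z' * z := by
    linear_combination ε * key + (M.det * y * (-1) + D * x - z' * z) * hε2
  have h3 : M.det * y ≤ D * x := by
    rw [key2]; linarith [mul_nonneg hz'0 hz0]
  have h4 : A i 0 * (M.det * y) ≤ A i 0 * (D * x) :=
    mul_le_mul_of_nonneg_left h3 (hA.nonneg _ _)
  have h5 : M.det * (A j 0 * x) ≤ M.det * (A i 0 * y) := mul_le_mul_of_nonneg_left hIH hM0.le
  refine le_of_mul_le_mul_right ?_ hxpos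
  linarith

end

/-! ### Factorization of totally nonnegative matrices -/

section

open Matrix Function

/-- Neville elimination: clearing the lowest nonzero entry of column `0` with the row directly above
it preserves total nonnegativity. -/
lemma TotallyNonneg.rowSub {n : ℕ} {A : Matrix (Fin (n + 1)) (Fin (n + 1)) ℝ}
    (hA : TotallyNonneg A) {i j : Fin (n + 1)} (hij : i.val + 1 = j.val)
    (hz : ∀ l, j < l → A l 0 = 0) (hi0 : 0 < A i 0) :
    TotallyNonneg (A.updateRow j (A j + (-(A j 0 / A i 0)) • A i)) := by
  intro k r c
  by_cases hj : ∃ s, r s = j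
  · obtain ⟨s, rfl⟩ := hj
    rw [det_updateRow_add_smul_submatrix A r c r.injective]
    by_cases hi : ∃ a, r a = i
    · obtain ⟨a, rfl⟩ := hi
      rw [det_submatrix_update_eq_zero, mul_zero, add_zero]
      · exact hA k r c
      · rintro rfl
        omega
    · push Not at hi
      have := hA.mul_det_update_le hij hz r.strictMono c.strictMono (s := s) rfl hi
      rw [neg_mul, ← sub_eq_add_neg, sub_nonneg, div_mul_eq_mul_div, div_le_iff₀ hi0,
        mul_comm _ (A i 0)]
      exact this
  · push Not at hj
    rw [updateRow_submatrix_of_notMem A r c j hj]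
    exact hA k r c

/-- The block diagonal matrix with blocks `1` and `B`. -/
def oneBlock {n : ℕ} (B : Matrix (Fin n) (Fin n) ℝ) : Matrix (Fin (n + 1)) (Fin (n + 1)) ℝ :=
  Matrix.of fun i j => Fin.cases (Fin.cases 1 (fun _ => 0) j)
    (fun i' => Fin.cases 0 (fun j' => B i' j') j) i

lemma ElementaryProduct.oneBlock {n : ℕ} {B : Matrix (Fin n) (Fin n) ℝ}
    (hB : ElementaryProduct B) : ElementaryProduct (oneBlock B) := by
  induction hB with
  | one =>
    convert ElementaryProduct.one
    ext i j
    refine Fin.cases ?_ (fun i => ?_) i <;> refine Fin.cases ?_ (fun j => ?_) j <;>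
      simp [BarrettJohnson.oneBlock, one_apply, Fin.succ_ne_zero, (Fin.succ_ne_zero _).symm]
  | @rowAdd A i j hij c hc _ ih =>
    convert ih.rowAdd i.succ j.succ (by simpa [Consecutive] using hij) c hc
    ext a b
    refine Fin.cases ?_ (fun a => ?_) a <;> refine Fin.cases ?_ (fun b => ?_) b <;>
      simp [BarrettJohnson.oneBlock, updateRow_apply, (Fin.succ_ne_zero _).symm]
  | @rowScale A i c hc _ ih =>
    convert ih.rowScale i.succ c hc
    ext a b
    refine Fin.cases ?_ (fun a => ?_) a <;> refine Fin.cases ?_ (fun b => ?_) b <;>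
      simp [BarrettJohnson.oneBlock, updateRow_apply, (Fin.succ_ne_zero _).symm]
  | @transpose A _ ih =>
    convert ih.transpose
    ext a b
    refine Fin.cases ?_ (fun a => ?_) a <;> refine Fin.cases ?_ (fun b => ?_) b <;>
      simp [BarrettJohnson.oneBlock]

lemma elementaryProduct_of_rowSub {n : ℕ} {A : Matrix (Fin n) (Fin n) ℝ} {i j : Fin n}
    (hij : Consecutive j i) {x : ℝ} (hx : 0 ≤ x)
    (h : ElementaryProduct (A.updateRow j (A j + (-x) • A i))) : ElementaryProduct A := by
  have := h.rowAdd j i hij x hx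
  rw [updateRow_idem, updateRow_self, updateRow_ne hij.ne.symm, add_assoc, neg_smul,
    neg_add_cancel, add_zero, updateRow_eq_self] at this
  exact this

lemma elementaryProduct_of_row_eq_zero {n : ℕ} {A : Matrix (Fin n) (Fin n) ℝ} {i : Fin n}
    (hi : A i = 0) (v : Fin n → ℝ) (h : ElementaryProduct (A.updateRow i v)) :
    ElementaryProduct A := by
  have := h.rowScale i 0 le_rfl
  rw [updateRow_idem, zero_smul, ← hi, updateRow_eq_self] at this
  exact this

/-- To factor a totally nonnegative matrix with positive corner into elementary matrices one may
assume that column `0` vanishes off the corner. The reduction does not touch row `0`, so it can be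
applied to columns and then to rows without undoing the first pass. Induction on `b`, beyond which
column `0` already vanishes. -/
lemma TotallyNonneg.elementaryProduct_of_clear_column {n : ℕ} (b : ℕ) :
    ∀ {A : Matrix (Fin (n + 1)) (Fin (n + 1)) ℝ}, TotallyNonneg A → 0 < A 0 0 →
    (∀ i : Fin (n + 1), b < i.val → A i 0 = 0) →
    (∀ A' : Matrix (Fin (n + 1)) (Fin (n + 1)) ℝ, TotallyNonneg A' → A' 0 = A 0 →
      (∀ i : Fin (n + 1), i ≠ 0 → A' i 0 = 0) → ElementaryProduct A') →
    ElementaryProduct A := by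
  induction b with
  | zero =>
    intro A hA _ hz H
    exact H A hA rfl fun i hi => hz i (Nat.pos_of_ne_zero (fun h => hi (Fin.ext h)))
  | succ b ih =>
    intro A hA h0 hz H
    by_cases hb : b + 1 < n + 1
    swap
    · exact ih hA h0 (fun i hi => absurd i.2 (by omega)) H
    set j : Fin (n + 1) := ⟨b + 1, hb⟩ with hj
    set i : Fin (n + 1) := ⟨b, by omega⟩ with hi
    have hij : i.val + 1 = j.val := rfl
    have hj0 : (0 : Fin (n + 1)) ≠ j := by rw [Ne, Fin.ext_iff]; simp [hj]
    have hzj : ∀ l, j < l → A l 0 = 0 := fun l hl => hz l hl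
    -- The elimination step, available once the entry directly above row `j` is positive.
    have step : ∀ {A : Matrix (Fin (n + 1)) (Fin (n + 1)) ℝ}, TotallyNonneg A → 0 < A 0 0 →
        (∀ i : Fin (n + 1), b + 1 < i.val → A i 0 = 0) →
        (∀ A' : Matrix (Fin (n + 1)) (Fin (n + 1)) ℝ, TotallyNonneg A' → A' 0 = A 0 →
          (∀ i : Fin (n + 1), i ≠ 0 → A' i 0 = 0) → ElementaryProduct A') →
        0 < A i 0 → ElementaryProduct A := by
      intro A hA h0 hz H hi0
      refine elementaryProduct_of_rowSub (i := i) (j := j) (Or.inr hij)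
        (x := A j 0 / A i 0) (div_nonneg (hA.nonneg _ _) hi0.le) ?_
      have hrow : (A.updateRow j (A j + (-(A j 0 / A i 0)) • A i)) 0 = A 0 := updateRow_ne hj0
      refine ih (hA.rowSub hij (fun l hl => hz l hl) hi0) (by rw [hrow]; exact h0) ?_
        (by rw [hrow]; exact H)
      intro l hl
      by_cases hlj : l = j
      · subst hlj
        simp [hi0.ne']
      · rw [updateRow_ne hlj]
        refine hz l (lt_of_le_of_ne hl fun h => hlj (Fin.ext h.symm))
    by_cases hj00 : A j 0 = 0
    · refine ih hA h0 (fun l hl => ?_) H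
      by_cases hlj : l = j
      · rw [hlj, hj00]
      · exact hz l (lt_of_le_of_ne hl fun h => hlj (Fin.ext h.symm))
    have hjpos : 0 < A j 0 := lt_of_le_of_ne (hA.nonneg _ _) (Ne.symm hj00)
    rcases (hA.nonneg i 0).eq_or_lt with hi0 | hi0
    · -- A zero entry above a positive one forces its whole row to vanish. The zero row is then
      -- filled with row `j`; scaling it by `0` recovers the matrix.
      have hrow : A i = 0 := by
        funext l
        rcases eq_or_ne l 0 with rfl | hl
        · exact hi0.symm
        · have h := hA.mul_le_mul (show i < j from Nat.lt_succ_self b)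
            (Fin.pos_of_ne_zero hl)
          rw [← hi0, zero_mul] at h
          exact le_antisymm (nonpos_of_mul_nonpos_left h hjpos) (hA.nonneg _ _)
      have hi00 : (0 : Fin (n + 1)) ≠ i := by
        rintro h
        rw [← h] at hi0
        exact h0.ne hi0
      have hcons : Consecutive i j := Or.inl hij
      refine elementaryProduct_of_row_eq_zero hrow (A i + (1 : ℝ) • A j) ?_
      have hrow0 : (A.updateRow i (A i + (1 : ℝ) • A j)) 0 = A 0 := updateRow_ne hi00
      refine step (hA.rowAdd hcons zero_le_one) (by rw [hrow0]; exact h0) ?_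
        (by rw [hrow0]; exact H) (by simp [← hi0, hjpos])
      intro l hl
      have hli : l ≠ i := by
        rintro rfl
        simp [hi] at hl
      rw [updateRow_ne hli]
      exact hz l hl
    · exact step hA h0 hz H hi0

/-- Replacing the first row by the first unit vector preserves total nonnegativity: a minor using
that row is either `0` or a smaller minor of the original matrix. -/
lemma TotallyNonneg.updateRow_zero_single {n : ℕ}
    {A : Matrix (Fin (n + 1)) (Fin (n + 1)) ℝ} (hA : TotallyNonneg A) :
    TotallyNonneg (A.updateRow 0 (Pi.single 0 1)) := by
  intro k r c
  by_cases hr : ∃ s, r s = 0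
  · obtain ⟨s, hs⟩ := hr
    obtain ⟨k, rfl⟩ : ∃ k', k = k' + 1 := ⟨k - 1, by have := s.2; omega⟩
    have hs0 : s = 0 := by
      by_contra h
      have := r.strictMono (Fin.pos_of_ne_zero h)
      rw [hs] at this
      exact absurd this (Fin.not_lt_zero _)
    subst hs0
    rw [← hs, updateRow_submatrix_of_injective A r c r.injective]
    rw [det_succ_row_zero, Fin.sum_univ_succ]
    have h1 : ∀ l : Fin k, (Pi.single (r 0) (1 : ℝ) ∘ c : Fin (k + 1) → ℝ) l.succ = 0 := by
      intro l
      rw [Function.comp_apply, hs, Pi.single_eq_of_ne]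
      have := c.strictMono (Fin.succ_pos l)
      exact (lt_of_le_of_lt (Fin.zero_le _) this).ne'
    simp only [updateRow_self, h1]
    simp only [mul_zero, zero_mul, Finset.sum_const_zero, add_zero, Fin.val_zero, pow_zero,
      one_mul]
    refine mul_nonneg ?_ ?_
    · simp only [Function.comp_apply, Pi.single_apply]
      split_ifs <;> norm_num
    · rw [show (Fin.succ : Fin k → Fin (k + 1)) = Fin.succAbove 0 from Fin.succAbove_zero.symm,
        submatrix_updateRow_succAbove, submatrix_submatrix]
      exact hA.det_nonneg (r.strictMono.comp (Fin.strictMono_succAbove _))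
        (c.strictMono.comp (Fin.strictMono_succAbove _))
  · push Not at hr
    rw [updateRow_submatrix_of_notMem A r c 0 hr]
    exact hA k r c

/-- The Loewner–Whitney–Cryer factorization: every totally nonnegative matrix, singular or not, is a
product of nonnegative diagonal and elementary bidiagonal matrices. -/
theorem TotallyNonneg.elementaryProduct {n : ℕ} {A : Matrix (Fin n) (Fin n) ℝ}
    (hA : TotallyNonneg A) : ElementaryProduct A := by
  induction n with
  | zero =>
    rw [Subsingleton.elim A 1]
    exact .one
  | succ n ih =>
  have main : ∀ {A : Matrix (Fin (n + 1)) (Fin (n + 1)) ℝ}, TotallyNonneg A → 0 < A 0 0 →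
      ElementaryProduct A := by
    intro A hA h0
    refine elementaryProduct_of_clear_column n hA h0 (fun i hi => absurd i.2 (by omega)) ?_
    intro A₁ hA₁ hrow₁ hcol₁
    have h01 : 0 < A₁ᵀ 0 0 := by rw [transpose_apply, hrow₁]; exact h0
    rw [← transpose_transpose A₁]
    refine ElementaryProduct.transpose ?_
    refine elementaryProduct_of_clear_column n hA₁.transpose h01
      (fun i hi => absurd i.2 (by omega)) ?_
    intro A₂ hA₂ hrow₂ hcol₂
    have h02 : 0 < A₂ 0 0 := by rw [hrow₂]; exact h01
    have hB : TotallyNonneg (A₂.submatrix Fin.succ Fin.succ) := fun k r c => by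
      rw [submatrix_submatrix]
      exact hA₂.det_nonneg (Fin.strictMono_succ.comp r.strictMono)
        (Fin.strictMono_succ.comp c.strictMono)
    have h := (ih hB).oneBlock.rowScale 0 (A₂ 0 0) h02.le
    convert h using 1
    ext a b
    have hr0 : ∀ b : Fin n, A₂ 0 b.succ = 0 := fun b => by
      rw [hrow₂, transpose_apply, hcol₁ _ (Fin.succ_ne_zero b)]
    refine Fin.cases ?_ (fun a => ?_) a <;> refine Fin.cases ?_ (fun b => ?_) b
    · simp [oneBlock]
    · simp [oneBlock, hr0]
    · simp [oneBlock, updateRow_ne, hcol₂ _ (Fin.succ_ne_zero a)]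
    · simp [oneBlock, updateRow_ne]
  have zeroRow : ∀ {A : Matrix (Fin (n + 1)) (Fin (n + 1)) ℝ}, TotallyNonneg A → A 0 = 0 →
      ElementaryProduct A := by
    intro A hA h
    refine elementaryProduct_of_row_eq_zero h (Pi.single 0 1) ?_
    exact main hA.updateRow_zero_single (by simp)
  -- If the corner entry is `0`, its row or its column vanishes and may be replaced by a unit
  -- vector.
  rcases (hA.nonneg 0 0).eq_or_lt with h0 | h0
  · by_cases hrow : A 0 = 0
    · exact zeroRow hA hrow
    · rw [← transpose_transpose A]
      refine ElementaryProduct.transpose (zeroRow hA.transpose ?_)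
      obtain ⟨l, hl⟩ : ∃ l, A 0 l ≠ 0 := by
        by_contra! h
        exact hrow (funext h)
      have hlpos : 0 < A 0 l := lt_of_le_of_ne (hA.nonneg _ _) (Ne.symm hl)
      have hl0 : l ≠ 0 := by rintro rfl; exact hl h0.symm
      funext i
      rcases eq_or_ne i 0 with rfl | hi
      · exact h0.symm
      · have h := hA.mul_le_mul (Fin.pos_of_ne_zero hi) (Fin.pos_of_ne_zero hl0)
        rw [← h0, zero_mul] at h
        exact le_antisymm (nonpos_of_mul_nonpos_right h hlpos) (hA.nonneg _ _)
  · exact main hA h0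

end

/-! ### Temperley–Lieb kernels and their traces -/

section

/-- Insert the two opposite letters `c, !c` at position `i` of the word `u`. -/
def insertPair (i : ℕ) (c : Bool) (u : List Bool) : List Bool :=
  u.take i ++ c :: (!c) :: u.drop i

/-- The cap at position `i`, as an operator on functions of words: sum over the two ways to insert a
pair of opposite letters. -/
def capAt (i : ℕ) (f : List Bool → ℝ) (u : List Bool) : ℝ :=
  f (insertPair i true u) + f (insertPair i false u)

/-- The cup at position `i`, the adjoint of `capAt i`: delete the letters at positions `i` and
`i + 1` if they are opposite, and return `0` if they are equal or missing. -/
def cupAt (i : ℕ) (f : List Bool → ℝ) (u : List Bool) : ℝ :=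
  match u.drop i with
  | a :: b :: w => if a = !b then f (u.take i ++ w) else 0
  | _ => 0

lemma insertPair_append {x : List Bool} {i : ℕ} (hx : x.length = i) (c : Bool) (y : List Bool) :
    insertPair i c (x ++ y) = x ++ c :: (!c) :: y := by
  subst hx; simp [insertPair]

lemma capAt_append {x : List Bool} {i : ℕ} (hx : x.length = i) (f : List Bool → ℝ)
    (y : List Bool) :
    capAt i f (x ++ y) = f (x ++ true :: false :: y) + f (x ++ false :: true :: y) := by
  simp [capAt, insertPair_append hx]

lemma cupAt_append {x : List Bool} {i : ℕ} (hx : x.length = i) (f : List Bool → ℝ) (a b : Bool)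
    (w : List Bool) : cupAt i f (x ++ a :: b :: w) = if a = !b then f (x ++ w) else 0 := by
  subst hx; simp [cupAt]

lemma length_insertPair {i : ℕ} {c : Bool} {u : List Bool} :
    (insertPair i c u).length = u.length + 2 := by
  simp [insertPair]; omega

lemma count_insertPair (i : ℕ) (c : Bool) (u : List Bool) :
    (insertPair i c u).count true = u.count true + 1 := by
  have h : u.count true = (u.take i).count true + (u.drop i).count true := by
    rw [← List.count_append, List.take_append_drop]
  rw [h]
  cases c <;> simp [insertPair, List.count_append] <;> omega

lemma exists_append_of_le {p i : ℕ} {u : List Bool} (hu : u.length = p) (hi : i ≤ p) :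
    ∃ x y, u = x ++ y ∧ x.length = i ∧ y.length = p - i :=
  ⟨u.take i, u.drop i, (List.take_append_drop i u).symm, by simp [hu, hi], by simp [hu]⟩

lemma exists_append_cons_cons {p i : ℕ} {u : List Bool} (hu : u.length = p + 2) (hi : i ≤ p) :
    ∃ x a b w, u = x ++ a :: b :: w ∧ x.length = i ∧ w.length = p - i := by
  obtain ⟨x, y, rfl, hx, hy⟩ := exists_append_of_le hu (show i ≤ p + 2 by omega)
  match y, hy with
  | a :: b :: w, hy => exact ⟨x, a, b, w, rfl, hx, by simp at hy; omega⟩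
  | [a], hy => simp at hy; omega
  | [], hy => simp at hy; omega

/-- The cone of nonnegative combinations of Temperley–Lieb diagrams with `p` upper and `q` lower
end points, acting on words in two colors. A diagram is represented by its kernel `K u v`, of which
only the values on words `u`, `v` of lengths `p`, `q` matter (`congr`). The diagrams are generated
in normal form, as cups attached on either side to the identity; that this is closed under composition
with caps is `capLeft` and `capRight`. Since colors are opposite at the two ends of a cup or cap
with no sign, a closed loop counts `2`. -/
inductive TemperleyLieb : ℕ → ℕ → (List Bool → List Bool → ℝ) → Prop
  | id (p : ℕ) : TemperleyLieb p p (fun u v => if u = v then 1 else 0)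
  | cupLeft {p q : ℕ} {K : List Bool → List Bool → ℝ} (i : ℕ) (hi : i ≤ p)
      (hK : TemperleyLieb p q K) :
      TemperleyLieb (p + 2) q (fun u v => cupAt i (fun x => K x v) u)
  | cupRight {p q : ℕ} {K : List Bool → List Bool → ℝ} (i : ℕ) (hi : i ≤ q)
      (hK : TemperleyLieb p q K) : TemperleyLieb p (q + 2) (fun u v => cupAt i (K u) v)
  | zero (p q : ℕ) : TemperleyLieb p q (fun _ _ => 0)
  | add {p q : ℕ} {K L : List Bool → List Bool → ℝ} (hK : TemperleyLieb p q K)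
      (hL : TemperleyLieb p q L) : TemperleyLieb p q (fun u v => K u v + L u v)
  | smul {p q : ℕ} {K : List Bool → List Bool → ℝ} (c : ℝ) (hc : 0 ≤ c)
      (hK : TemperleyLieb p q K) : TemperleyLieb p q (fun u v => c * K u v)
  | congr {p q : ℕ} {K L : List Bool → List Bool → ℝ} (hK : TemperleyLieb p q K)
      (h : ∀ u v, u.length = p → v.length = q → K u v = L u v) : TemperleyLieb p q L

namespace TemperleyLieb

variable {p q : ℕ} {K : List Bool → List Bool → ℝ}

lemma flip (hK : TemperleyLieb p q K) : TemperleyLieb q p (fun u v => K v u) := by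
  induction hK with
  | id p => exact (id p).congr fun u v _ _ => by simp [eq_comm]
  | cupLeft i hi _ ih => exact ih.cupRight i hi
  | cupRight i hi _ ih => exact ih.cupLeft i hi
  | zero p q => exact zero q p
  | add _ _ ih₁ ih₂ => exact ih₁.add ih₂
  | smul c hc _ ih => exact ih.smul c hc
  | congr _ h ih => exact ih.congr fun u v hu hv => h v u hv hu

/-- A cap meeting a cup gives twice the identity, or the identity, or slides past it. -/
lemma capLeft_aux {r : ℕ} (hK : TemperleyLieb r q K) :
    ∀ (p j : ℕ), r = p + 2 → j ≤ p →
      TemperleyLieb p q (fun u v => capAt j (fun x => K x v) u) := by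
  induction hK with
  | id r =>
    rintro p j rfl hj
    refine ((id p).cupRight j hj).congr fun u v hu hv => ?_
    obtain ⟨x, y, rfl, hx, hy⟩ := exists_append_of_le hu hj
    obtain ⟨x', a, b, w, rfl, hx', hw⟩ := exists_append_cons_cons hv hj
    rw [cupAt_append hx', capAt_append hx]
    have h : ∀ y w, x ++ y = x' ++ w ↔ x = x' ∧ y = w := fun y w =>
      ⟨fun e => List.append_inj e (hx.trans hx'.symm), by rintro ⟨rfl, rfl⟩; rfl⟩
    simp only [h, List.cons.injEq]
    cases a <;> cases b <;> simp
  | @cupLeft s q K i hi hK ih =>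
    intro p j hp hj
    obtain rfl : s = p := by omega
    rcases lt_trichotomy i j with hij | rfl | hij
    · rcases Nat.lt_or_ge (i + 1) j with hij' | hij'
      · obtain ⟨s, rfl⟩ : ∃ s', s = s' + 2 := ⟨s - 2, by omega⟩
        refine ((ih s (j - 2) rfl (by omega)).cupLeft i (by omega)).congr fun u v hu hv => ?_
        obtain ⟨x, y, rfl, hx, hy⟩ := exists_append_of_le hu hj
        obtain ⟨x, a, b, w, rfl, hx', hw⟩ :=
          exists_append_cons_cons (show x.length = (j - 2) + 2 by omega) (show i ≤ j - 2 by omega)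
        rw [capAt_append hx]
        simp only [List.append_assoc, List.cons_append, cupAt_append hx']
        split_ifs
        · rw [← List.append_assoc, capAt_append (by simp [hx', hw]; omega)]
          simp
        · simp
      · obtain rfl : j = i + 1 := by omega
        refine hK.congr fun u v hu hv => ?_
        obtain ⟨x, y, rfl, hx, hy⟩ := exists_append_of_le hu (show i ≤ s by omega)
        match y, hy with
        | [], hy => simp at hy; omega
        | d :: y, hy =>
        rw [show x ++ d :: y = (x ++ [d]) ++ y by simp, capAt_append (by simp [hx])]
        simp only [List.append_assoc, List.cons_append, cupAt_append hx, List.nil_append]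
        cases d <;> simp
    · refine (hK.smul 2 zero_le_two).congr fun u v hu hv => ?_
      obtain ⟨x, y, rfl, hx, hy⟩ := exists_append_of_le hu hj
      rw [capAt_append hx]
      beta_reduce
      rw [cupAt_append hx, cupAt_append hx]
      simp
      ring
    · rcases Nat.lt_or_ge (j + 1) i with hij' | hij'
      · obtain ⟨s, rfl⟩ : ∃ s', s = s' + 2 := ⟨s - 2, by omega⟩
        refine ((ih s j rfl (by omega)).cupLeft (i - 2) (by omega)).congr fun u v hu hv => ?_
        obtain ⟨x, y, rfl, hx, hy⟩ := exists_append_of_le hu hj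
        obtain ⟨z, a, b, w, rfl, hz, hw⟩ :=
          exists_append_cons_cons (show y.length = (s - j) + 2 by omega)
            (show i - 2 - j ≤ s - j by omega)
        rw [capAt_append hx, ← List.append_assoc, cupAt_append (by simp [hx, hz]; omega)]
        beta_reduce
        rw [show x ++ true :: false :: (z ++ a :: b :: w) =
            (x ++ true :: false :: z) ++ a :: b :: w by simp,
          show x ++ false :: true :: (z ++ a :: b :: w) =
            (x ++ false :: true :: z) ++ a :: b :: w by simp,
          cupAt_append (by simp [hx, hz]; omega), cupAt_append (by simp [hx, hz]; omega)]
        split_ifs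
        · rw [List.append_assoc, capAt_append hx]
          simp
        · simp
      · obtain rfl : i = j + 1 := by omega
        refine hK.congr fun u v hu hv => ?_
        obtain ⟨x, y, rfl, hx, hy⟩ := exists_append_of_le hu hj
        match y, hy with
        | [], hy => simp at hy; omega
        | d :: y, hy =>
        rw [capAt_append hx]
        beta_reduce
        rw [show x ++ true :: false :: d :: y = (x ++ [true]) ++ false :: d :: y by
            simp, show x ++ false :: true :: d :: y = (x ++ [false]) ++ true :: d :: y by simp,
          cupAt_append (by simp [hx]), cupAt_append (by simp [hx])]
        cases d <;> simp
  | @cupRight s q K i hi hK ih =>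
    intro p j hp hj
    refine ((ih p j hp hj).cupRight i hi).congr fun u v hu hv => ?_
    obtain ⟨x, a, b, w, rfl, hx, hw⟩ := exists_append_cons_cons hv hi
    simp only [capAt, cupAt_append hx]
    split_ifs <;> simp
  | zero r q =>
    intro p j _ _
    exact (zero p q).congr fun u v _ _ => by simp [capAt]
  | add _ _ ih₁ ih₂ =>
    intro p j hp hj
    exact ((ih₁ p j hp hj).add (ih₂ p j hp hj)).congr fun u v _ _ => by simp [capAt]; ring
  | smul c hc _ ih =>
    intro p j hp hj
    exact ((ih p j hp hj).smul c hc).congr fun u v _ _ => by simp [capAt]; ring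
  | congr _ h ih =>
    rintro p j rfl hj
    refine (ih p j rfl hj).congr fun u v hu hv => ?_
    simp only [capAt]
    rw [h _ _ (by rw [length_insertPair, hu]) hv, h _ _ (by rw [length_insertPair, hu]) hv]

lemma capLeft (hK : TemperleyLieb (p + 2) q K) {j : ℕ} (hj : j ≤ p) :
    TemperleyLieb p q (fun u v => capAt j (fun x => K x v) u) :=
  hK.capLeft_aux p j rfl hj

lemma capRight (hK : TemperleyLieb p (q + 2) K) {j : ℕ} (hj : j ≤ q) :
    TemperleyLieb p q (fun u v => capAt j (K u) v) :=
  (hK.flip.capLeft hj).flip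

end TemperleyLieb

/-- The sum of `f u` over all words `u` of length `p`. -/
def sumWords : ℕ → (List Bool → ℝ) → ℝ
  | 0, f => f []
  | p + 1, f => sumWords p (fun u => f (true :: u)) + sumWords p (fun u => f (false :: u))

lemma sumWords_congr {p : ℕ} {f g : List Bool → ℝ} (h : ∀ u, u.length = p → f u = g u) :
    sumWords p f = sumWords p g := by
  induction p generalizing f g with
  | zero => exact h [] rfl
  | succ p ih =>
    simp only [sumWords]
    rw [ih fun u hu => h (true :: u) (by simp [hu]), ih fun u hu => h (false :: u) (by simp [hu])]

lemma sumWords_add (p : ℕ) (f g : List Bool → ℝ) :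
    sumWords p (fun u => f u + g u) = sumWords p f + sumWords p g := by
  induction p generalizing f g with
  | zero => rfl
  | succ p ih => simp only [sumWords, ih]; ring

lemma sumWords_mul (p : ℕ) (c : ℝ) (f : List Bool → ℝ) :
    sumWords p (fun u => c * f u) = c * sumWords p f := by
  induction p generalizing f with
  | zero => rfl
  | succ p ih => simp only [sumWords, ih]; ring

lemma sumWords_zero (p : ℕ) : sumWords p (fun _ => 0) = 0 := by
  simpa using sumWords_mul p 0 (fun _ => 0)

/-- Summing over the words on which a cup does not vanish amounts to summing over the insertions of
an opposite pair, so a cup can be moved cyclically around a trace to become a cap. -/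
lemma sumWords_cupAt {i p : ℕ} (hi : i ≤ p) (g : List Bool → List Bool → ℝ) :
    sumWords (p + 2) (fun u => cupAt i (fun x => g x u) u) =
      sumWords p (fun u => capAt i (g u) u) := by
  induction i generalizing p g with
  | zero => simp [sumWords, cupAt, capAt, insertPair, sumWords_zero, sumWords_add]
  | succ i ih =>
    obtain ⟨p, rfl⟩ : ∃ p', p = p' + 1 := ⟨p - 1, by omega⟩
    have h : ∀ a : Bool,
        sumWords (p + 2) (fun u => cupAt (i + 1) (fun x => g x (a :: u)) (a :: u)) =
        sumWords p (fun u => capAt (i + 1) (g (a :: u)) (a :: u)) := by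
      intro a
      refine Eq.trans (sumWords_congr fun u hu => ?_)
        ((ih (p := p) (by omega) (fun x u => g (a :: x) (a :: u))).trans
          (sumWords_congr fun u hu => ?_))
      · obtain ⟨x, b, c, w, rfl, hx, hw⟩ := exists_append_cons_cons hu (show i ≤ p by omega)
        rw [cupAt_append hx, ← List.cons_append, cupAt_append (by simp [hx])]
        rfl
      · simp [capAt, insertPair]
    exact congrArg₂ (· + ·) (h true) (h false)

/-- The trace of the kernel `K` on the words of length `p` with exactly `k` letters `true`. -/
def wordTrace (p : ℕ) (K : List Bool → List Bool → ℝ) (k : ℕ) : ℝ :=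
  sumWords p (fun u => if u.count true = k then K u u else 0)

/-- The sequence `f` is nonnegative and `f k / p.choose k` is weakly increasing for `k ≤ p / 2`,
written without denominators. -/
def NormalizedMonotone (p : ℕ) (f : ℕ → ℝ) : Prop :=
  (∀ k, 0 ≤ f k) ∧ ∀ k : ℕ, 2 * (k + 1) ≤ p → ((p : ℝ) - k) * f k ≤ ((k : ℝ) + 1) * f (k + 1)

lemma wordTrace_id (p k : ℕ) :
    wordTrace p (fun u v => if u = v then 1 else 0) k = (p.choose k : ℝ) := by
  simp only [wordTrace, if_true]
  induction p generalizing k with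
  | zero => cases k <;> simp [sumWords]
  | succ p ih =>
    simp only [sumWords]
    cases k with
    | zero => simpa [sumWords_zero] using ih 0
    | succ k => simpa [Nat.choose_succ_succ] using congrArg₂ (· + ·) (ih k) (ih (k + 1))

/-- Cyclicity of the trace for a cup. An opposite pair contains exactly one letter `true`, hence the
shift of `k` by one. -/
lemma wordTrace_cupLeft {p i : ℕ} (hi : i ≤ p) (K : List Bool → List Bool → ℝ) (k : ℕ) :
    wordTrace (p + 2) (fun u v => cupAt i (fun x => K x v) u) k =
      match k with
      | 0 => 0
      | k + 1 => wordTrace p (fun u v => capAt i (K u) v) k := by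
  have h := sumWords_cupAt hi (fun x u => if u.count true = k then K x u else 0)
  have h1 : wordTrace (p + 2) (fun u v => cupAt i (fun x => K x v) u) k =
      sumWords (p + 2) (fun u => cupAt i (fun x => if u.count true = k then K x u else 0) u) := by
    refine sumWords_congr fun u hu => ?_
    obtain ⟨x, b, c, w, rfl, hx, hw⟩ := exists_append_cons_cons hu hi
    simp only [cupAt_append hx]
    split_ifs <;> rfl
  rw [h1, h]
  cases k with
  | zero => simp [capAt, count_insertPair, sumWords_zero]
  | succ k =>
    refine sumWords_congr fun u hu => ?_
    simp only [capAt, count_insertPair, Nat.add_right_cancel_iff]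
    split_ifs <;> simp

lemma NormalizedMonotone.shift {p : ℕ} {f : ℕ → ℝ} (hf : NormalizedMonotone p f) :
    NormalizedMonotone (p + 2) (fun k => match k with | 0 => 0 | k + 1 => f k) := by
  refine ⟨fun k => ?_, fun k hk => ?_⟩
  · cases k with
    | zero => exact le_rfl
    | succ k => exact hf.1 k
  · cases k with
    | zero => simpa using hf.1 0
    | succ k =>
      have h1 := hf.2 k (by omega)
      have h2 : ((k : ℝ) + 1) ≤ p - k := by
        have : 2 * ((k : ℝ) + 1) ≤ p := by exact_mod_cast (show 2 * (k + 1) ≤ p by omega)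
        linarith
      have h3 : f k ≤ f (k + 1) := by
        refine le_of_mul_le_mul_left ?_ (show (0 : ℝ) < k + 1 by positivity)
        exact (mul_le_mul_of_nonneg_right h2 (hf.1 k)).trans h1
      push_cast
      linarith

/-- Traces of Temperley–Lieb diagrams satisfy `NormalizedMonotone`. The identity has trace
`p.choose k`; the trace of a diagram with a cup is the shifted trace of a diagram with two strands
fewer, and this shift preserves the property. -/
theorem TemperleyLieb.normalizedMonotone_wordTrace (N : ℕ) :
    ∀ {p q : ℕ} {K : List Bool → List Bool → ℝ}, p ≤ N → p = q → TemperleyLieb p q K →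
      NormalizedMonotone p (wordTrace p K) := by
  induction N using Nat.strong_induction_on with
  | _ N IH =>
  intro p q K hpN hpq hK
  induction hK with
  | id p =>
    simp only [NormalizedMonotone, wordTrace_id]
    refine ⟨fun k => Nat.cast_nonneg _, fun k hk => le_of_eq ?_⟩
    have := Nat.choose_succ_right_eq p k
    have h : ((p - k : ℕ) : ℝ) = p - k := Nat.cast_sub (by omega)
    rw [← h]
    norm_cast
    rw [mul_comm, ← this, mul_comm]
  | @cupLeft p q K i hi hK ih =>
    subst hpq
    have h := IH p (by omega) le_rfl rfl (hK.capRight hi)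
    have h' := h.shift
    rwa [← funext (wordTrace_cupLeft hi K)] at h'
  | @cupRight p q K i hi hK ih =>
    subst hpq
    have h := IH q (by omega) le_rfl rfl (hK.flip.capRight hi)
    have h' := h.shift
    rw [← funext (wordTrace_cupLeft hi (fun u v => K v u))] at h'
    exact h'
  | zero p q =>
    have : wordTrace p (fun _ _ => 0) = fun _ => 0 := by
      funext k; simp [wordTrace, sumWords_zero]
    rw [this]
    exact ⟨fun _ => le_rfl, fun k _ => by simp⟩
  | @add p q K L _ _ ih₁ ih₂ =>
    have : wordTrace p (fun u v => K u v + L u v) = fun k => wordTrace p K k + wordTrace p L k := by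
      funext k
      simp only [wordTrace]
      rw [← sumWords_add]
      exact sumWords_congr fun u _ => by split_ifs <;> simp
    rw [this]
    have h1 := ih₁ hpN hpq
    have h2 := ih₂ hpN hpq
    refine ⟨fun k => add_nonneg (h1.1 k) (h2.1 k), fun k hk => ?_⟩
    rw [mul_add, mul_add]
    exact add_le_add (h1.2 k hk) (h2.2 k hk)
  | @smul p q K c hc _ ih =>
    have : wordTrace p (fun u v => c * K u v) = fun k => c * wordTrace p K k := by
      funext k
      simp only [wordTrace]
      rw [← sumWords_mul]
      exact sumWords_congr fun u _ => by split_ifs <;> simp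
    rw [this]
    have h1 := ih hpN hpq
    refine ⟨fun k => mul_nonneg hc (h1.1 k), fun k hk => ?_⟩
    rw [mul_left_comm, mul_left_comm _ c]
    exact mul_le_mul_of_nonneg_left (h1.2 k hk) hc
  | @congr p q K L _ h ih =>
    subst hpq
    have : wordTrace p L = wordTrace p K := by
      funext k
      exact sumWords_congr fun u hu => by rw [h u u hu hu]
    rw [this]
    exact ih hpN rfl

end

/-! ### Minors and pairs of index sets -/

section

open Matrix Function

variable {n : ℕ}

/-- The minor of `A` with row set `I` and column set `I'`, both listed in increasing order; `0` if
the two sets have different cardinalities. -/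
noncomputable def sortedMinor (A : Matrix (Fin n) (Fin n) ℝ) (I I' : Finset (Fin n)) : ℝ :=
  if h : I'.card = I.card then
    (A.submatrix (I.orderEmbOfFin rfl) (I'.orderEmbOfFin h)).det
  else 0

lemma sortedMinor_of_card_ne (A : Matrix (Fin n) (Fin n) ℝ) {I I' : Finset (Fin n)}
    (h : I'.card ≠ I.card) : sortedMinor A I I' = 0 := dif_neg h

lemma sortedMinor_eq (A : Matrix (Fin n) (Fin n) ℝ) {I I' : Finset (Fin n)} {k : ℕ}
    {r c : Fin k → Fin n} (hr : StrictMono r) (hc : StrictMono c) (hk : I.card = k)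
    (hk' : I'.card = k) (hI : ∀ a, r a ∈ I) (hI' : ∀ a, c a ∈ I') :
    sortedMinor A I I' = (A.submatrix r c).det := by
  subst hk
  rw [sortedMinor, dif_pos hk', Finset.orderEmbOfFin_unique rfl hI hr,
    Finset.orderEmbOfFin_unique hk' hI' hc]

lemma sortedMinor_self (A : Matrix (Fin n) (Fin n) ℝ) (I : Finset (Fin n)) :
    sortedMinor A I I = principalMinor A I := by
  rw [sortedMinor, dif_pos rfl, principalMinor,
    ← det_submatrix_equiv_self (I.orderIsoOfFin rfl).toEquiv, submatrix_submatrix]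
  rfl

lemma sortedMinor_one (I I' : Finset (Fin n)) :
    sortedMinor (1 : Matrix (Fin n) (Fin n) ℝ) I I' = if I = I' then 1 else 0 := by
  split_ifs with h
  · subst h
    rw [sortedMinor_self, principalMinor, submatrix_one _ Subtype.val_injective, det_one]
  · by_cases hc : I'.card = I.card
    · rw [sortedMinor, dif_pos hc]
      obtain ⟨i, hi, hi'⟩ : ∃ i ∈ I, i ∉ I' := by
        by_contra! hsub
        exact h (Finset.eq_of_subset_of_card_le hsub hc.le)
      obtain ⟨a, rfl⟩ : i ∈ Set.range (I.orderEmbOfFin rfl) := by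
        rw [Finset.range_orderEmbOfFin]; exact hi
      refine det_eq_zero_of_row_eq_zero a fun b => ?_
      rw [submatrix_apply, one_apply_ne]
      intro h
      rw [h] at hi'
      exact hi' (Finset.orderEmbOfFin_mem _ _ _)
    · exact sortedMinor_of_card_ne _ hc

lemma sortedMinor_transpose (A : Matrix (Fin n) (Fin n) ℝ) (I I' : Finset (Fin n)) :
    sortedMinor Aᵀ I I' = sortedMinor A I' I := by
  by_cases h : I'.card = I.card
  · rw [sortedMinor_eq A (I'.orderEmbOfFin h).strictMono (I.orderEmbOfFin rfl).strictMono h rfl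
      (Finset.orderEmbOfFin_mem _ _) (Finset.orderEmbOfFin_mem _ _), sortedMinor, dif_pos h,
      ← det_transpose, transpose_submatrix, transpose_transpose]
  · rw [sortedMinor_of_card_ne _ h, sortedMinor_of_card_ne _ (Ne.symm h)]

lemma sortedMinor_rowScale (A : Matrix (Fin n) (Fin n) ℝ) (i : Fin n) (c : ℝ)
    (I I' : Finset (Fin n)) :
    sortedMinor (A.updateRow i (c • A i)) I I' =
      (if i ∈ I then c else 1) * sortedMinor A I I' := by
  by_cases hc : I'.card = I.card
  swap
  · simp [sortedMinor_of_card_ne _ hc]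
  rw [sortedMinor, sortedMinor, dif_pos hc, dif_pos hc]
  split_ifs with hi
  · obtain ⟨s, rfl⟩ : i ∈ Set.range (I.orderEmbOfFin rfl) := by
      rw [Finset.range_orderEmbOfFin]; exact hi
    rw [updateRow_submatrix_of_injective A _ _ (I.orderEmbOfFin rfl).injective]
    have h := det_updateRow_smul (A.submatrix (I.orderEmbOfFin rfl) (I'.orderEmbOfFin hc)) s c
      (A.submatrix (I.orderEmbOfFin rfl) (I'.orderEmbOfFin hc) s)
    rw [updateRow_eq_self] at h
    exact h
  · rw [updateRow_submatrix_of_notMem, one_mul]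
    rintro a rfl
    exact hi (Finset.orderEmbOfFin_mem _ _ _)

/-- Replace the element `i` of `I` by `j`. -/
def moveSite (i j : Fin n) (I : Finset (Fin n)) : Finset (Fin n) := insert j (I.erase i)

lemma mem_moveSite {i j l : Fin n} {I : Finset (Fin n)} :
    l ∈ moveSite i j I ↔ l = j ∨ l ≠ i ∧ l ∈ I := by
  simp [moveSite]

/-- Adding a multiple of row `j` to the adjacent row `i` changes the minors by moving the index `i`
to `j`. As `i` and `j` are adjacent, the increasing order is kept and no sign appears. -/
lemma sortedMinor_rowAdd (A : Matrix (Fin n) (Fin n) ℝ) {i j : Fin n} (hij : Consecutive i j)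
    (c : ℝ) (I I' : Finset (Fin n)) :
    sortedMinor (A.updateRow i (A i + c • A j)) I I' = sortedMinor A I I' +
      c * if i ∈ I ∧ j ∉ I then sortedMinor A (moveSite i j I) I' else 0 := by
  by_cases hc : I'.card = I.card
  swap
  · rw [sortedMinor_of_card_ne _ hc, sortedMinor_of_card_ne _ hc]
    split_ifs with h
    · rw [sortedMinor_of_card_ne]
      · simp
      · rw [moveSite, Finset.card_insert_of_notMem (by simp [h.2]),
          Finset.card_erase_add_one h.1]
        exact hc
    · simp
  by_cases hi : i ∈ I
  · set r := I.orderEmbOfFin rfl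
    obtain ⟨s, rfl⟩ : i ∈ Set.range r := by
      rw [Finset.range_orderEmbOfFin]; exact hi
    rw [sortedMinor, dif_pos hc, det_updateRow_add_smul_submatrix A _ _ r.injective, sortedMinor,
      dif_pos hc]
    congr 2
    by_cases hj : j ∈ I
    · rw [if_neg (by simp [hj])]
      obtain ⟨a, rfl⟩ : j ∈ Set.range r := by
        rw [Finset.range_orderEmbOfFin]; exact hj
      exact det_submatrix_update_eq_zero A _ _ (fun h => hij.ne (by rw [h]))
    · rw [if_pos ⟨hi, hj⟩]
      have hcard : (moveSite (r s) j I).card = I.card := by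
        rw [moveSite, Finset.card_insert_of_notMem (by simp [hj]), Finset.card_erase_add_one hi]
      refine (sortedMinor_eq A (strictMono_update_of_consecutive r.strictMono hij ?_)
        (I'.orderEmbOfFin hc).strictMono hcard hc (fun a => ?_)
        (Finset.orderEmbOfFin_mem _ _)).symm
      · rintro a rfl
        exact hj (Finset.orderEmbOfFin_mem _ _ _)
      · rw [mem_moveSite]
        by_cases ha : a = s
        · subst ha; simp
        · right
          rw [update_of_ne ha]
          exact ⟨r.injective.ne ha, Finset.orderEmbOfFin_mem _ _ _⟩
  · rw [if_neg (by simp [hi]), mul_zero, add_zero, sortedMinor, sortedMinor, dif_pos hc,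
      dif_pos hc, updateRow_submatrix_of_notMem]
    rintro a rfl
    exact hi (Finset.orderEmbOfFin_mem _ _ _)

/-- The number of the two sets `I`, `J` that contain `i`. -/
def occupancy (I J : Finset (Fin n)) (i : Fin n) : ℕ :=
  (if i ∈ I then 1 else 0) + (if i ∈ J then 1 else 0)

/-- The color of a site that lies in exactly one of the two sets: `true` for `I`, `false` for `J`.
Sites in both sets or in neither have no color. -/
def siteColor (I J : Finset (Fin n)) (i : Fin n) : Option Bool :=
  if i ∈ I then if i ∈ J then none else some true else if i ∈ J then some false else none

/-- The colors of the sites in `L` that lie in exactly one of `I`, `J`, in the order of `L`. -/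
def wordOn (L : List (Fin n)) (I J : Finset (Fin n)) : List Bool :=
  L.filterMap (siteColor I J)

/-- The number of sites in `L` with occupancy `1`. -/
def singles (L : List (Fin n)) (ν : Fin n → ℕ) : ℕ := (L.filter (fun i => ν i = 1)).length

lemma length_wordOn (L : List (Fin n)) (I J : Finset (Fin n)) :
    (wordOn L I J).length = singles L (occupancy I J) := by
  induction L with
  | nil => rfl
  | cons l L ih =>
    by_cases h1 : l ∈ I <;> by_cases h2 : l ∈ J <;>
      simp_all [wordOn, singles, siteColor, occupancy]

lemma wordOn_congr {L : List (Fin n)} {I J I₁ J₁ : Finset (Fin n)}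
    (hI : ∀ l ∈ L, (l ∈ I ↔ l ∈ I₁)) (hJ : ∀ l ∈ L, (l ∈ J ↔ l ∈ J₁)) :
    wordOn L I J = wordOn L I₁ J₁ := by
  refine List.filterMap_congr fun l hl => ?_
  simp only [siteColor, hI l hl, hJ l hl]

lemma singles_congr {L : List (Fin n)} {ν μ : Fin n → ℕ} (h : ∀ l ∈ L, ν l = μ l) :
    singles L ν = singles L μ := by
  unfold singles
  rw [List.filter_congr fun l hl => by rw [h l hl]]

lemma mem_iff_of_wordOn_eq {L : List (Fin n)} {I J I' J' : Finset (Fin n)}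
    (hocc : occupancy I J = occupancy I' J') (hw : wordOn L I J = wordOn L I' J') :
    ∀ l ∈ L, (l ∈ I ↔ l ∈ I') ∧ (l ∈ J ↔ l ∈ J') := by
  induction L with
  | nil => simp
  | cons a L ih =>
    have h := congrFun hocc a
    have key : ((a ∈ I ↔ a ∈ I') ∧ (a ∈ J ↔ a ∈ J')) ∧ wordOn L I J = wordOn L I' J' := by
      by_cases h1 : a ∈ I <;> by_cases h2 : a ∈ J <;> by_cases h3 : a ∈ I' <;>
        by_cases h4 : a ∈ J' <;> simp [occupancy, h1, h2, h3, h4] at h <;>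
        simp [wordOn, siteColor, h1, h2, h3, h4] at hw ⊢ <;> exact hw
    intro l hl
    rcases List.mem_cons.1 hl with rfl | hl
    · exact key.1
    · exact ih key.2 l hl

/-- For fixed occupancies of row and column indices, the product of two minors
`det A[I, I'] * det A[J, J']` depends on the color words of `(I, J)` and `(I', J')` through a
nonnegative combination of Temperley–Lieb diagrams. -/
def HasPlanarKernels (A : Matrix (Fin n) (Fin n) ℝ) : Prop :=
  ∀ ν ν' : Fin n → ℕ, ∃ K : List Bool → List Bool → ℝ,
    TemperleyLieb (singles (List.finRange n) ν) (singles (List.finRange n) ν') K ∧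
    ∀ I J I' J' : Finset (Fin n), occupancy I J = ν → occupancy I' J' = ν' →
      sortedMinor A I I' * sortedMinor A J J' =
        K (wordOn (List.finRange n) I J) (wordOn (List.finRange n) I' J')

lemma HasPlanarKernels.one : HasPlanarKernels (1 : Matrix (Fin n) (Fin n) ℝ) := by
  intro ν ν'
  by_cases h : ν = ν'
  · subst h
    refine ⟨_, .id _, fun I J I' J' hν hν' => ?_⟩
    have hocc := hν.trans hν'.symm
    rw [sortedMinor_one, sortedMinor_one]
    by_cases hw : wordOn (List.finRange n) I J = wordOn (List.finRange n) I' J'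
    · have h := mem_iff_of_wordOn_eq hocc hw
      have hI : I = I' := Finset.ext fun l => (h l (List.mem_finRange l)).1
      have hJ : J = J' := Finset.ext fun l => (h l (List.mem_finRange l)).2
      simp [hI, hJ]
    · rw [if_neg hw]
      by_cases hI : I = I'
      · by_cases hJ : J = J'
        · subst hI; subst hJ; exact absurd rfl hw
        · simp [hJ]
      · simp [hI]
  · refine ⟨_, .zero _ _, fun I J I' J' hν hν' => ?_⟩
    rw [sortedMinor_one, sortedMinor_one]
    by_cases hI : I = I'
    · by_cases hJ : J = J'
      · subst hI; subst hJ; exact absurd (hν.symm.trans hν') h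
      · simp [hJ]
    · simp [hI]

lemma HasPlanarKernels.transpose {A : Matrix (Fin n) (Fin n) ℝ} (hA : HasPlanarKernels A) :
    HasPlanarKernels Aᵀ := by
  intro ν ν'
  obtain ⟨K, hK, h⟩ := hA ν' ν
  refine ⟨_, hK.flip, fun I J I' J' hν hν' => ?_⟩
  rw [sortedMinor_transpose, sortedMinor_transpose]
  exact h I' J' I J hν' hν

lemma HasPlanarKernels.rowScale {A : Matrix (Fin n) (Fin n) ℝ} (hA : HasPlanarKernels A)
    (i : Fin n) {c : ℝ} (hc : 0 ≤ c) : HasPlanarKernels (A.updateRow i (c • A i)) := by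
  intro ν ν'
  obtain ⟨K, hK, h⟩ := hA ν ν'
  refine ⟨_, hK.smul (c ^ ν i) (pow_nonneg hc _), fun I J I' J' hν hν' => ?_⟩
  rw [sortedMinor_rowScale, sortedMinor_rowScale, ← h I J I' J' hν hν', ← hν]
  by_cases h1 : i ∈ I <;> by_cases h2 : i ∈ J <;> simp [occupancy, h1, h2] <;> ring

/-- The occupancy after one particle has moved from site `i` to site `j`. -/
def moveOcc (i j : Fin n) (ν : Fin n → ℕ) : Fin n → ℕ :=
  update (update ν i (ν i - 1)) j (ν j + 1)

lemma moveOcc_apply {i j l : Fin n} (hi : l ≠ i) (hj : l ≠ j) (ν : Fin n → ℕ) :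
    moveOcc i j ν l = ν l := by
  simp [moveOcc, hi, hj]

lemma moveOcc_left {i j : Fin n} (h : i ≠ j) (ν : Fin n → ℕ) : moveOcc i j ν i = ν i - 1 := by
  simp [moveOcc, h]

lemma moveOcc_right (i j : Fin n) (ν : Fin n → ℕ) : moveOcc i j ν j = ν j + 1 := by
  simp [moveOcc]

lemma occupancy_moveSite_left {i j : Fin n} (hij : i ≠ j) {I J : Finset (Fin n)} (hi : i ∈ I)
    (hj : j ∉ I) : occupancy (moveSite i j I) J = moveOcc i j (occupancy I J) := by
  funext l
  by_cases h1 : l = j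
  · subst h1; simp [occupancy, moveOcc, mem_moveSite, hj]; ring
  · by_cases h2 : l = i
    · subst h2; simp [occupancy, moveOcc, mem_moveSite, hi, hij]
    · simp [occupancy, moveOcc, mem_moveSite, h1, h2]

lemma occupancy_comm (I J : Finset (Fin n)) : occupancy I J = occupancy J I := by
  funext l
  exact add_comm _ _

lemma occupancy_moveSite_right {i j : Fin n} (hij : i ≠ j) {I J : Finset (Fin n)} (hi : i ∈ J)
    (hj : j ∉ J) : occupancy I (moveSite i j J) = moveOcc i j (occupancy I J) := by
  rw [occupancy_comm, occupancy_moveSite_left hij hi hj, occupancy_comm]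

lemma exists_finRange_eq {i j : Fin n} (hij : i.val + 1 = j.val) :
    ∃ P S, List.finRange n = P ++ i :: j :: S ∧ i ∉ P ∧ j ∉ P ∧ i ∉ S ∧ j ∉ S := by
  have hlen : (List.finRange n).length = n := List.length_finRange
  have h : List.finRange n =
      (List.finRange n).take i ++ i :: j :: (List.finRange n).drop (j + 1) := by
    conv_lhs => rw [← List.take_append_drop i (List.finRange n)]
    rw [List.drop_eq_getElem_cons (by rw [hlen]; exact i.2)]
    rw [List.drop_eq_getElem_cons (by rw [hlen, hij]; exact j.2)]
    simp [hij]
  refine ⟨_, _, h, ?_⟩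
  have hnd := List.nodup_finRange n
  rw [h, List.nodup_append] at hnd
  obtain ⟨_, h2, h3⟩ := hnd
  simp only [List.nodup_cons, List.mem_cons, not_or] at h2
  refine ⟨fun hp => h3 _ hp i (by simp) rfl, fun hp => h3 _ hp j (by simp) rfl, h2.1.2, h2.2.1⟩

end

/-! ### Row operations act by cups, caps and strands -/

section

open Matrix Function

variable {n : ℕ}

set_option linter.unusedSimpArgs false in
/-- Adding a multiple of a row to an adjacent one preserves `HasPlanarKernels`. Each of the two
minors may move its index from site `i` to site `j`. According to the occupancies of `i` and `j`, one such
move is an identity strand (`(1, 0)` and `(2, 1)`), a cup (`(1, 1)`), or a cap (`(2, 0)`, the only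
case in which both minors can move), and in all other cases no move is possible. -/
lemma HasPlanarKernels.rowAdd {A : Matrix (Fin n) (Fin n) ℝ} (hA : HasPlanarKernels A)
    {i j : Fin n} (hij : Consecutive i j) {c : ℝ} (hc : 0 ≤ c) :
    HasPlanarKernels (A.updateRow i (A i + c • A j)) := by
  have hne : i ≠ j := hij.ne
  -- The sites `x`, `y` are `i`, `j` in increasing order; words are cut into the parts before, at,
  -- and after them.
  obtain ⟨P, S, x, y, hL, hiP, hjP, hiS, hjS, hxy⟩ : ∃ P S x y,
      List.finRange n = P ++ x :: y :: S ∧ i ∉ P ∧ j ∉ P ∧ i ∉ S ∧ j ∉ S ∧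
        ((x = i ∧ y = j) ∨ (x = j ∧ y = i)) := by
    rcases hij with h | h
    · obtain ⟨P, S, h0, h1, h2, h3, h4⟩ := exists_finRange_eq h
      exact ⟨P, S, i, j, h0, h1, h2, h3, h4, Or.inl ⟨rfl, rfl⟩⟩
    · obtain ⟨P, S, h0, h1, h2, h3, h4⟩ := exists_finRange_eq h
      exact ⟨P, S, j, i, h0, h2, h1, h4, h3, Or.inr ⟨rfl, rfl⟩⟩
  have hsingles : ∀ μ : Fin n → ℕ, singles (List.finRange n) μ =
      singles P μ + singles S μ + (if μ i = 1 then 1 else 0) + (if μ j = 1 then 1 else 0) := by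
    intro μ
    rw [hL]
    rcases hxy with ⟨rfl, rfl⟩ | ⟨rfl, rfl⟩ <;>
    · simp only [singles, List.filter_append, List.length_append, List.filter_cons]
      by_cases h1 : μ x = 1 <;> by_cases h2 : μ y = 1 <;> simp [h1, h2] <;> omega
  have hsinglesP : ∀ μ : Fin n → ℕ, singles P (moveOcc i j μ) = singles P μ := fun μ =>
    singles_congr fun l hl => moveOcc_apply (by rintro rfl; exact hiP hl)
      (by rintro rfl; exact hjP hl) μ
  have hsinglesS : ∀ μ : Fin n → ℕ, singles S (moveOcc i j μ) = singles S μ := fun μ =>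
    singles_congr fun l hl => moveOcc_apply (by rintro rfl; exact hiS hl)
      (by rintro rfl; exact hjS hl) μ
  have hmove : ∀ {L : List (Fin n)}, i ∉ L → j ∉ L → ∀ I : Finset (Fin n), ∀ l ∈ L,
      (l ∈ moveSite i j I ↔ l ∈ I) := by
    intro L hi hj I l hl
    have h1 : l ≠ i := by rintro rfl; exact hi hl
    have h2 : l ≠ j := by rintro rfl; exact hj hl
    simp [mem_moveSite, h1, h2]
  have hword : ∀ I J : Finset (Fin n), wordOn (List.finRange n) I J =
      wordOn P I J ++ ((siteColor I J x).toList ++ ((siteColor I J y).toList ++ wordOn S I J)) := by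
    intro I J
    rw [hL]
    simp only [wordOn, List.filterMap_append, List.filterMap_cons]
    cases siteColor I J x <;> cases siteColor I J y <;> simp
  intro ν ν'
  obtain ⟨K₀, hK₀, h₀⟩ := hA ν ν'
  obtain ⟨K₁, hK₁, h₁⟩ := hA (moveOcc i j ν) ν'
  obtain ⟨K₂, hK₂, h₂⟩ := hA (moveOcc i j (moveOcc i j ν)) ν'
  -- The terms of first and second order in `c`, which account for one and two moves.
  suffices ∃ T, TemperleyLieb (singles (List.finRange n) ν) (singles (List.finRange n) ν') T ∧
      ∀ I J I' J' : Finset (Fin n), occupancy I J = ν → occupancy I' J' = ν' →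
        c * ((if i ∈ I ∧ j ∉ I then sortedMinor A (moveSite i j I) I' else 0) *
            sortedMinor A J J') +
          c * (sortedMinor A I I' *
            (if i ∈ J ∧ j ∉ J then sortedMinor A (moveSite i j J) J' else 0)) +
          c ^ 2 * ((if i ∈ I ∧ j ∉ I then sortedMinor A (moveSite i j I) I' else 0) *
            (if i ∈ J ∧ j ∉ J then sortedMinor A (moveSite i j J) J' else 0)) =
        T (wordOn (List.finRange n) I J) (wordOn (List.finRange n) I' J') by
    obtain ⟨T, hT, h⟩ := this
    refine ⟨_, hK₀.add hT, fun I J I' J' hν hν' => ?_⟩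
    rw [sortedMinor_rowAdd A hij, sortedMinor_rowAdd A hij, ← h I J I' J' hν hν',
      ← h₀ I J I' J' hν hν']
    ring
  have hleft : ∀ I J I' J' : Finset (Fin n), occupancy I J = ν → occupancy I' J' = ν' →
      i ∈ I → j ∉ I → sortedMinor A (moveSite i j I) I' * sortedMinor A J J' =
        K₁ (wordOn (List.finRange n) (moveSite i j I) J) (wordOn (List.finRange n) I' J') := by
    intro I J I' J' hν hν' hi hj
    exact h₁ _ _ _ _ (by rw [occupancy_moveSite_left hne hi hj, hν]) hν'
  have hright : ∀ I J I' J' : Finset (Fin n), occupancy I J = ν → occupancy I' J' = ν' →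
      i ∈ J → j ∉ J → sortedMinor A I I' * sortedMinor A (moveSite i j J) J' =
        K₁ (wordOn (List.finRange n) I (moveSite i j J)) (wordOn (List.finRange n) I' J') := by
    intro I J I' J' hν hν' hi hj
    exact h₁ _ _ _ _ (by rw [occupancy_moveSite_right hne hi hj, hν]) hν'
  have hboth : ∀ I J I' J' : Finset (Fin n), occupancy I J = ν → occupancy I' J' = ν' →
      i ∈ I → j ∉ I → i ∈ J → j ∉ J →
      sortedMinor A (moveSite i j I) I' * sortedMinor A (moveSite i j J) J' =
        K₂ (wordOn (List.finRange n) (moveSite i j I) (moveSite i j J))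
          (wordOn (List.finRange n) I' J') := by
    intro I J I' J' hν hν' hi hj hi' hj'
    exact h₂ _ _ _ _ (by rw [occupancy_moveSite_left hne hi hj,
      occupancy_moveSite_right hne hi' hj', hν]) hν'
  have hwP : ∀ I J I₁ J₁ : Finset (Fin n), (I₁ = I ∨ I₁ = moveSite i j I) →
      (J₁ = J ∨ J₁ = moveSite i j J) →
      wordOn P I₁ J₁ = wordOn P I J ∧ wordOn S I₁ J₁ = wordOn S I J := by
    rintro I J I₁ J₁ (rfl | rfl) (rfl | rfl) <;>
      exact ⟨wordOn_congr (by simp +contextual [hmove hiP hjP])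
          (by simp +contextual [hmove hiP hjP]),
        wordOn_congr (by simp +contextual [hmove hiS hjS])
          (by simp +contextual [hmove hiS hjS])⟩
  have hlen : ∀ I J : Finset (Fin n), occupancy I J = ν →
      (wordOn P I J).length = singles P ν := by
    rintro I J rfl
    exact length_wordOn _ _ _
  have hsi := hsingles ν
  have hsi₁ := hsingles (moveOcc i j ν)
  have hsi₂ := hsingles (moveOcc i j (moveOcc i j ν))
  simp only [hsinglesP, hsinglesS, moveOcc_left hne, moveOcc_right] at hsi₁ hsi₂
  have hwl : ∀ I J : Finset (Fin n), wordOn (List.finRange n) (moveSite i j I) J =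
      wordOn P I J ++ ((siteColor (moveSite i j I) J x).toList ++
        ((siteColor (moveSite i j I) J y).toList ++ wordOn S I J)) := fun I J => by
    obtain ⟨e₁, e₂⟩ := hwP I J _ J (Or.inr rfl) (Or.inl rfl)
    rw [hword, e₁, e₂]
  have hwr : ∀ I J : Finset (Fin n), wordOn (List.finRange n) I (moveSite i j J) =
      wordOn P I J ++ ((siteColor I (moveSite i j J) x).toList ++
        ((siteColor I (moveSite i j J) y).toList ++ wordOn S I J)) := fun I J => by
    obtain ⟨e₁, e₂⟩ := hwP I J I _ (Or.inl rfl) (Or.inr rfl)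
    rw [hword, e₁, e₂]
  have hwb : ∀ I J : Finset (Fin n),
      wordOn (List.finRange n) (moveSite i j I) (moveSite i j J) =
      wordOn P I J ++ ((siteColor (moveSite i j I) (moveSite i j J) x).toList ++
        ((siteColor (moveSite i j I) (moveSite i j J) y).toList ++ wordOn S I J)) := fun I J => by
    obtain ⟨e₁, e₂⟩ := hwP I J _ _ (Or.inr rfl) (Or.inr rfl)
    rw [hword, e₁, e₂]
  have hocc : ∀ I J : Finset (Fin n), occupancy I J = ν →
      (if i ∈ I then 1 else 0) + (if i ∈ J then 1 else 0) = ν i ∧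
        (if j ∈ I then 1 else 0) + (if j ∈ J then 1 else 0) = ν j := by
    rintro I J rfl
    exact ⟨rfl, rfl⟩
  by_cases h10 : ν i = 1 ∧ ν j = 0
  · have e : singles (List.finRange n) (moveOcc i j ν) = singles (List.finRange n) ν := by
      rw [hsi, hsi₁]; simp [h10]
    rw [e] at hK₁
    refine ⟨_, hK₁.smul c hc, fun I J I' J' hν hν' => ?_⟩
    obtain ⟨oi, oj⟩ := hocc I J hν
    rw [h10.1] at oi
    rw [h10.2] at oj
    by_cases a1 : i ∈ I <;> by_cases a2 : i ∈ J <;> by_cases a3 : j ∈ I <;>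
      by_cases a4 : j ∈ J <;> simp [a1, a2, a3, a4] at oi oj
    · simp only [a1, a2, a3, a4, not_true, not_false_iff, and_true, and_false, false_and, if_true,
        if_false, mul_zero, zero_mul, add_zero]
      rw [hleft I J I' J' hν hν' a1 a3, hwl, hword I J]
      rcases hxy with ⟨rfl, rfl⟩ | ⟨rfl, rfl⟩ <;>
        simp [siteColor, mem_moveSite, a1, a2, a3, a4, hne, hne.symm]
    · simp only [a1, a2, a3, a4, not_true, not_false_iff, and_true, and_false, false_and, if_true,
        if_false, mul_zero, zero_mul, add_zero, zero_add]
      rw [hright I J I' J' hν hν' a2 a4, hwr, hword I J]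
      rcases hxy with ⟨rfl, rfl⟩ | ⟨rfl, rfl⟩ <;>
        simp [siteColor, mem_moveSite, a1, a2, a3, a4, hne, hne.symm]
  by_cases h21 : ν i = 2 ∧ ν j = 1
  · have e : singles (List.finRange n) (moveOcc i j ν) = singles (List.finRange n) ν := by
      rw [hsi, hsi₁]; simp [h21]
    rw [e] at hK₁
    refine ⟨_, hK₁.smul c hc, fun I J I' J' hν hν' => ?_⟩
    obtain ⟨oi, oj⟩ := hocc I J hν
    rw [h21.1] at oi
    rw [h21.2] at oj
    by_cases a1 : i ∈ I <;> by_cases a2 : i ∈ J <;> by_cases a3 : j ∈ I <;>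
      by_cases a4 : j ∈ J <;> simp [a1, a2, a3, a4] at oi oj
    · simp only [a1, a2, a3, a4, not_true, not_false_iff, and_true, and_false, false_and, if_true,
        if_false, mul_zero, zero_mul, add_zero, zero_add]
      rw [hright I J I' J' hν hν' a2 a4, hwr, hword I J]
      rcases hxy with ⟨rfl, rfl⟩ | ⟨rfl, rfl⟩ <;>
        simp [siteColor, mem_moveSite, a1, a2, a3, a4, hne, hne.symm]
    · simp only [a1, a2, a3, a4, not_true, not_false_iff, and_true, and_false, false_and, if_true,
        if_false, mul_zero, zero_mul, add_zero]
      rw [hleft I J I' J' hν hν' a1 a3, hwl, hword I J]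
      rcases hxy with ⟨rfl, rfl⟩ | ⟨rfl, rfl⟩ <;>
        simp [siteColor, mem_moveSite, a1, a2, a3, a4, hne, hne.symm]
  by_cases h11 : ν i = 1 ∧ ν j = 1
  · have e : singles (List.finRange n) ν = singles (List.finRange n) (moveOcc i j ν) + 2 := by
      rw [hsi, hsi₁]; simp [h11]
    have hT := hK₁.cupLeft (singles P ν) (by rw [hsi₁]; omega)
    rw [← e] at hT
    refine ⟨_, hT.smul c hc, fun I J I' J' hν hν' => ?_⟩
    obtain ⟨oi, oj⟩ := hocc I J hν
    rw [h11.1] at oi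
    rw [h11.2] at oj
    have hl := hlen I J hν
    by_cases a1 : i ∈ I <;> by_cases a2 : i ∈ J <;> by_cases a3 : j ∈ I <;>
      by_cases a4 : j ∈ J <;> simp [a1, a2, a3, a4] at oi oj
    · simp only [a1, a2, a3, a4, not_true, not_false_iff, and_true, and_false, false_and, if_true,
        if_false, mul_zero, zero_mul, add_zero]
      rw [hword I J]
      rcases hxy with ⟨rfl, rfl⟩ | ⟨rfl, rfl⟩ <;>
        simp [siteColor, a1, a2, a3, a4, cupAt_append hl]
    · simp only [a1, a2, a3, a4, not_true, not_false_iff, and_true, and_false, false_and, if_true,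
        if_false, mul_zero, zero_mul, add_zero]
      rw [hleft I J I' J' hν hν' a1 a3, hwl, hword I J]
      rcases hxy with ⟨rfl, rfl⟩ | ⟨rfl, rfl⟩ <;>
        simp [siteColor, mem_moveSite, a1, a2, a3, a4, hne, hne.symm, cupAt_append hl]
    · simp only [a1, a2, a3, a4, not_true, not_false_iff, and_true, and_false, false_and, if_true,
        if_false, mul_zero, zero_mul, add_zero, zero_add]
      rw [hright I J I' J' hν hν' a2 a4, hwr, hword I J]
      rcases hxy with ⟨rfl, rfl⟩ | ⟨rfl, rfl⟩ <;>
        simp [siteColor, mem_moveSite, a1, a2, a3, a4, hne, hne.symm, cupAt_append hl]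
    · simp only [a1, a2, a3, a4, not_true, not_false_iff, and_true, and_false, false_and, if_true,
        if_false, mul_zero, zero_mul, add_zero]
      rw [hword I J]
      rcases hxy with ⟨rfl, rfl⟩ | ⟨rfl, rfl⟩ <;>
        simp [siteColor, a1, a2, a3, a4, cupAt_append hl]
  by_cases h20 : ν i = 2 ∧ ν j = 0
  · have e : singles (List.finRange n) (moveOcc i j ν) = singles (List.finRange n) ν + 2 := by
      rw [hsi, hsi₁]; simp [h20]
    have e₂ : singles (List.finRange n) (moveOcc i j (moveOcc i j ν)) =
        singles (List.finRange n) ν := by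
      rw [hsi, hsi₂]; simp [h20]
    rw [e] at hK₁
    rw [e₂] at hK₂
    have hT := hK₁.capLeft (j := singles P ν) (by rw [hsi]; omega)
    refine ⟨_, (hT.smul c hc).add (hK₂.smul (c ^ 2) (sq_nonneg c)), fun I J I' J' hν hν' => ?_⟩
    obtain ⟨oi, oj⟩ := hocc I J hν
    rw [h20.1] at oi
    rw [h20.2] at oj
    have hl := hlen I J hν
    by_cases a1 : i ∈ I <;> by_cases a2 : i ∈ J <;> by_cases a3 : j ∈ I <;>
      by_cases a4 : j ∈ J <;> simp [a1, a2, a3, a4] at oi oj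
    simp only [a1, a2, a3, a4, not_false_iff, and_true, if_true]
    rw [hleft I J I' J' hν hν' a1 a3, hright I J I' J' hν hν' a2 a4,
      hboth I J I' J' hν hν' a1 a3 a2 a4, hwl, hwr, hwb, hword I J]
    rcases hxy with ⟨rfl, rfl⟩ | ⟨rfl, rfl⟩ <;>
      simp [siteColor, mem_moveSite, a1, a2, a3, a4, hne, hne.symm, capAt_append hl] <;> ring
  · refine ⟨_, .zero _ _, fun I J I' J' hν hν' => ?_⟩
    obtain ⟨oi, oj⟩ := hocc I J hν
    rw [← oi, ← oj] at h10 h21 h11 h20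
    by_cases a1 : i ∈ I <;> by_cases a2 : i ∈ J <;> by_cases a3 : j ∈ I <;>
      by_cases a4 : j ∈ J <;> simp [a1, a2, a3, a4] at h10 h21 h11 h20 ⊢

theorem ElementaryProduct.hasPlanarKernels {A : Matrix (Fin n) (Fin n) ℝ}
    (hA : ElementaryProduct A) : HasPlanarKernels A := by
  induction hA with
  | one => exact .one
  | rowAdd i j hij c hc _ ih => exact ih.rowAdd hij hc
  | rowScale i c hc _ ih => exact ih.rowScale i hc
  | transpose _ ih => exact ih.transpose

end

/-! ### The inequality for two blocks -/

section

open Matrix Function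

variable {n : ℕ}

lemma sumWords_eq_sum_powerset {α : Type*} [DecidableEq α] {L : List α} (hL : L.Nodup)
    (F : List Bool → ℝ) :
    sumWords L.length F =
      ∑ X ∈ L.toFinset.powerset, F (L.map fun l => decide (l ∈ X)) := by
  induction L generalizing F with
  | nil => simp [sumWords]
  | cons a L ih =>
    rw [List.nodup_cons] at hL
    have ha : a ∉ L.toFinset := by simpa using hL.1
    rw [List.toFinset_cons, Finset.sum_powerset_insert ha, List.length_cons, sumWords,
      ih hL.2, ih hL.2, add_comm]
    congr 1 <;> refine Finset.sum_congr rfl fun X hX => ?_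
    · have haX : a ∉ X := fun h => ha (Finset.mem_powerset.1 hX h)
      simp [haX]
    · have h : ∀ l ∈ L, decide (l ∈ X) = decide (l ∈ insert a X) := by
        intro l hl
        have : l ≠ a := by rintro rfl; exact hL.1 hl
        simp [this]
      rw [List.map_congr_left h]
      simp

lemma count_map_decide_mem {α : Type*} [DecidableEq α] {L : List α} (hL : L.Nodup)
    {X : Finset α} (hX : X ⊆ L.toFinset) :
    (L.map fun l => decide (l ∈ X)).count true = X.card := by
  have h : (L.filter (· ∈ X)).toFinset = X := by
    ext l
    simp only [List.toFinset_filter, Finset.mem_filter, decide_eq_true_eq]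
    exact ⟨fun h => h.2, fun h => ⟨hX h, h⟩⟩
  rw [← h, List.toFinset_card_of_nodup (hL.filter _), h, List.count, List.countP_map,
    List.countP_eq_length_filter]
  congr 1
  exact List.filter_congr fun l _ => by simp

lemma wordOn_sdiff (L : List (Fin n)) {T X : Finset (Fin n)} (hX : X ⊆ T) :
    wordOn L X (T \ X) = (L.filter (· ∈ T)).map fun l => decide (l ∈ X) := by
  induction L with
  | nil => rfl
  | cons a L ih =>
    simp only [wordOn] at ih
    by_cases h1 : a ∈ X
    · have h2 := hX h1
      simp [wordOn, siteColor, h1, h2, ih]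
    · by_cases h2 : a ∈ T <;> simp [wordOn, siteColor, h1, h2, ih]

/-- The inequality for two blocks: among the splittings of `T` into two parts, the average of the
product of the principal minors of the parts increases as their sizes become more equal. The sum
over the splittings is the trace of a Temperley–Lieb kernel, the occupancy being `1` on `T` and `0`
elsewhere. -/
theorem TotallyNonneg.normalizedMonotone {A : Matrix (Fin n) (Fin n) ℝ} (hA : TotallyNonneg A)
    (T : Finset (Fin n)) :
    NormalizedMonotone T.card fun k =>
      ∑ X ∈ T.powersetCard k, principalMinor A X * principalMinor A (T \ X) := by
  obtain ⟨K, hK, h⟩ := hA.elementaryProduct.hasPlanarKernels (occupancy T ∅) (occupancy T ∅)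
  have hocc : ∀ X ⊆ T, occupancy X (T \ X) = occupancy T ∅ := by
    intro X hX
    funext l
    by_cases h1 : l ∈ X
    · simp [occupancy, h1, hX h1]
    · by_cases h2 : l ∈ T <;> simp [occupancy, h1, h2]
  set M := (List.finRange n).filter (· ∈ T) with hM
  have hMn : M.Nodup := (List.nodup_finRange n).filter _
  have hMT : M.toFinset = T := by ext l; simp [hM]
  have hlen : singles (List.finRange n) (occupancy T ∅) = M.length := by
    unfold singles
    congr 1
    exact List.filter_congr fun l _ => by simp [occupancy]
  have hcard : M.length = T.card := by rw [← hMT, List.toFinset_card_of_nodup hMn]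
  rw [hlen] at hK
  have hmono := TemperleyLieb.normalizedMonotone_wordTrace M.length le_rfl rfl hK
  rw [← hcard]
  convert hmono using 1
  funext k
  rw [wordTrace, sumWords_eq_sum_powerset hMn, hMT, Finset.powersetCard_eq_filter,
    Finset.sum_filter]
  refine Finset.sum_congr rfl fun X hX => ?_
  have hXT := Finset.mem_powerset.1 hX
  rw [count_map_decide_mem hMn (hMT.symm ▸ hXT), ← wordOn_sdiff _ hXT,
    ← h _ _ _ _ (hocc X hXT) (hocc X hXT), sortedMinor_self, sortedMinor_self]

lemma TotallyNonneg.principalMinor_nonneg {A : Matrix (Fin n) (Fin n) ℝ} (hA : TotallyNonneg A)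
    (I : Finset (Fin n)) : 0 ≤ principalMinor A I := by
  rw [← sortedMinor_self, sortedMinor, dif_pos rfl]
  exact hA _ _ _

end

/-! ### Transfers between blocks and majorization -/

section

open Function

variable {n : ℕ}

section Families

variable {ι : Type*} [Fintype ι] [DecidableEq ι]

/-- The families of pairwise disjoint subsets of `Fin n` with prescribed sizes `l`, indexed by any
finite type and with empty members allowed. -/
def disjointFamilies (n : ℕ) (l : ι → ℕ) : Finset (ι → Finset (Fin n)) :=
  {I | (∀ k, (I k).card = l k) ∧ ∀ j k, j ≠ k → Disjoint (I j) (I k)}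

lemma mem_disjointFamilies {l : ι → ℕ} {I : ι → Finset (Fin n)} :
    I ∈ disjointFamilies n l ↔
      (∀ k, (I k).card = l k) ∧ ∀ j k, j ≠ k → Disjoint (I j) (I k) := by
  simp [disjointFamilies]

lemma prod_eq_mul_mul {M : Type*} [CommMonoid M] {a b : ι} (hab : a ≠ b) (f : ι → M) :
    ∏ k, f k = f a * f b * ∏ k ∈ (Finset.univ.erase a).erase b, f k := by
  rw [← Finset.mul_prod_erase _ _ (Finset.mem_univ a),
    ← Finset.mul_prod_erase (Finset.univ.erase a) _
      (Finset.mem_erase.2 ⟨hab.symm, Finset.mem_univ b⟩), mul_assoc]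

/-- Group the families by the union of their members `a` and `b`, stored as member `a` of a family
whose member `b` is empty. -/
lemma sum_disjointFamilies (g : Finset (Fin n) → ℝ) {a b : ι} (hab : a ≠ b) (l : ι → ℕ) :
    ∑ I ∈ disjointFamilies n l, ∏ k, g (I k) =
      ∑ I ∈ disjointFamilies n (update (update l a (l a + l b)) b 0),
        (∏ k ∈ (Finset.univ.erase a).erase b, g (I k)) *
          ∑ X ∈ (I a).powersetCard (l b), g X * g (I a \ X) := by
  simp_rw [Finset.mul_sum]
  rw [Finset.sum_sigma']
  refine Finset.sum_bij'
    (fun I _ => ⟨update (update I a (I a ∪ I b)) b ∅, I b⟩)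
    (fun p _ => update (update p.1 a (p.1 a \ p.2)) b p.2) ?_ ?_ ?_ ?_ ?_
  · intro I hI
    rw [mem_disjointFamilies] at hI
    obtain ⟨hc, hd⟩ := hI
    simp only [Finset.mem_sigma, mem_disjointFamilies, Finset.mem_powersetCard]
    refine ⟨⟨fun k => ?_, fun j k hjk => ?_⟩, ?_, hc b⟩
    · by_cases hkb : k = b
      · subst hkb; simp
      · by_cases hka : k = a
        · subst hka
          simp [hab, Finset.card_union_of_disjoint (hd _ _ hab), hc]
        · simp [hka, hkb, hc]
    · by_cases hjb : j = b
      · subst hjb; simp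
      by_cases hkb : k = b
      · subst hkb; simp
      by_cases hja : j = a
      · subst hja
        simp only [update_of_ne hab, update_self, update_of_ne hkb, update_of_ne hjk.symm]
        exact Finset.disjoint_union_left.2 ⟨hd _ _ hjk, hd _ _ (Ne.symm hkb)⟩
      by_cases hka : k = a
      · subst hka
        simp only [update_of_ne hab, update_self, update_of_ne hjb, update_of_ne hja]
        exact Finset.disjoint_union_right.2 ⟨hd _ _ hjk, hd _ _ hjb⟩
      simp only [update_of_ne hjb, update_of_ne hja, update_of_ne hkb, update_of_ne hka]
      exact hd _ _ hjk
    · simp [hab]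
  · rintro ⟨I, X⟩ hI
    simp only [Finset.mem_sigma, mem_disjointFamilies, Finset.mem_powersetCard] at hI
    obtain ⟨⟨hc, hd⟩, hX, hXc⟩ := hI
    rw [mem_disjointFamilies]
    have hca : (I a).card = l a + l b := by rw [hc]; simp [hab]
    refine ⟨fun k => ?_, fun j k hjk => ?_⟩
    · by_cases hkb : k = b
      · subst hkb; simp [hXc]
      by_cases hka : k = a
      · subst hka
        simp [hab, Finset.card_sdiff_of_subset hX, hca, hXc]
      · simp [hka, hkb, hc]
    · by_cases hjb : j = b
      · subst hjb
        by_cases hka : k = a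
        · subst hka
          simp only [update_of_ne hab, update_self]
          exact Finset.disjoint_sdiff
        · simp only [update_of_ne hka, update_self, update_of_ne hjk.symm]
          exact (hd _ _ (Ne.symm hka)).mono_left hX
      by_cases hkb : k = b
      · subst hkb
        by_cases hja : j = a
        · subst hja
          simp only [update_of_ne hab, update_self]
          exact Finset.sdiff_disjoint
        · simp only [update_of_ne hja, update_self, update_of_ne hjb]
          exact (hd _ _ hja).mono_right hX
      by_cases hja : j = a
      · subst hja
        simp only [update_of_ne hab, update_self, update_of_ne hkb, update_of_ne hjk.symm]
        exact (hd _ _ hjk).mono_left Finset.sdiff_subset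
      by_cases hka : k = a
      · subst hka
        simp only [update_of_ne hab, update_self, update_of_ne hjb, update_of_ne hja]
        exact (hd _ _ hjk).mono_right Finset.sdiff_subset
      simp only [update_of_ne hjb, update_of_ne hja, update_of_ne hkb, update_of_ne hka]
      exact hd _ _ hjk
  · intro I hI
    rw [mem_disjointFamilies] at hI
    funext k
    by_cases hkb : k = b
    · subst hkb; simp
    by_cases hka : k = a
    · subst hka
      simp only [update_of_ne hab, update_self]
      exact Finset.union_sdiff_cancel_right (hI.2 _ _ hab)
    · simp [hka, hkb]
  · rintro ⟨I, X⟩ hI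
    simp only [Finset.mem_sigma, mem_disjointFamilies, Finset.mem_powersetCard] at hI
    obtain ⟨⟨hc, hd⟩, hX, hXc⟩ := hI
    have hIb : I b = ∅ := by
      rw [← Finset.card_eq_zero, hc]; simp
    simp only [Sigma.mk.injEq]
    refine ⟨?_, by simp⟩
    funext k
    by_cases hkb : k = b
    · subst hkb; simp [hIb]
    by_cases hka : k = a
    · subst hka
      simp only [update_of_ne hab, update_self]
      exact Finset.sdiff_union_of_subset hX
    · simp [hka, hkb]
  · intro I hI
    rw [mem_disjointFamilies] at hI
    rw [prod_eq_mul_mul hab]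
    simp only [update_of_ne hab, update_self]
    rw [Finset.union_sdiff_cancel_right (hI.2 _ _ hab), mul_comm, mul_comm (g (I a))]
    congr 1
    refine Finset.prod_congr rfl fun k hk => ?_
    simp only [Finset.mem_erase] at hk
    rw [update_of_ne hk.1, update_of_ne hk.2.1]

/-- The weighted sum of products of principal minors over all families of disjoint sets of sizes
`l`, for sizes in any order and possibly zero. -/
noncomputable def weightedMinorSum (A : Matrix (Fin n) (Fin n) ℝ) (l : ι → ℕ) : ℝ :=
  (∏ k, (l k).factorial : ℕ) * ∑ I ∈ disjointFamilies n l, ∏ k, principalMinor A (I k)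

/-- Moving one unit from a larger size to a smaller one that stays at most as large does not
decrease the weighted sum. -/
theorem TotallyNonneg.weightedMinorSum_le_transfer {A : Matrix (Fin n) (Fin n) ℝ}
    (hA : TotallyNonneg A) {a b : ι} (hab : a ≠ b) {l : ι → ℕ} (h : l b + 2 ≤ l a) :
    weightedMinorSum A l ≤
      weightedMinorSum A (update (update l a (l a - 1)) b (l b + 1)) := by
  obtain ⟨d, hd⟩ : ∃ d, l a = d + 1 := ⟨l a - 1, by omega⟩
  set l' := update (update l a (l a - 1)) b (l b + 1) with hl'
  have hla : l' a = d := by simp [hl', hab, hd]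
  have hlb : l' b = l b + 1 := by simp [hl']
  have h0 : update (update l' a (l' a + l' b)) b 0 = update (update l a (l a + l b)) b 0 := by
    funext k
    by_cases hkb : k = b
    · subst hkb; simp
    by_cases hka : k = a
    · subst hka; simp [hab, hla, hlb, hd]; omega
    · simp [hka, hkb, hl']
  have hW : ∏ k ∈ (Finset.univ.erase a).erase b, (l' k).factorial =
      ∏ k ∈ (Finset.univ.erase a).erase b, (l k).factorial := by
    refine Finset.prod_congr rfl fun k hk => ?_
    simp only [Finset.mem_erase] at hk
    rw [hl', update_of_ne hk.1, update_of_ne hk.2.1]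
  unfold weightedMinorSum
  rw [sum_disjointFamilies _ hab l, sum_disjointFamilies _ hab l', h0, prod_eq_mul_mul hab,
    prod_eq_mul_mul hab, hW, hla, hlb, Finset.mul_sum, Finset.mul_sum]
  refine Finset.sum_le_sum fun I hI => ?_
  rw [mem_disjointFamilies] at hI
  have hcard : (I a).card = d + 1 + l b := by rw [hI.1]; simp [hab, hd]
  have hmono := (hA.normalizedMonotone (I a)).2 (l b) (by omega)
  simp only [hcard] at hmono
  set f := ∑ X ∈ (I a).powersetCard (l b), principalMinor A X * principalMinor A (I a \ X)
  set f' := ∑ X ∈ (I a).powersetCard (l b + 1), principalMinor A X * principalMinor A (I a \ X)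
  set W := ∏ k ∈ (Finset.univ.erase a).erase b, (l k).factorial
  set R := ∏ k ∈ (Finset.univ.erase a).erase b, principalMinor A (I k)
  have hR : 0 ≤ R := Finset.prod_nonneg fun k _ => hA.principalMinor_nonneg _
  rw [hd, Nat.factorial_succ, Nat.factorial_succ]
  push_cast at hmono ⊢
  have hpos : 0 ≤ (d.factorial : ℝ) * ((l b).factorial : ℝ) * (W : ℝ) * R := by positivity
  have := mul_le_mul_of_nonneg_left hmono hpos
  linarith

end Families

lemma sum_range_transfer {M : ℕ → ℕ} {p q : ℕ} (hpq : p ≠ q) (hp : 1 ≤ M p) (i : ℕ) :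
    ∑ k ∈ Finset.range i, update (update M p (M p - 1)) q (M q + 1) k + (if p < i then 1 else 0) =
      ∑ k ∈ Finset.range i, M k + (if q < i then 1 else 0) := by
  induction i with
  | zero => simp
  | succ i ih =>
    rw [Finset.sum_range_succ, Finset.sum_range_succ]
    by_cases hiq : i = q
    · subst hiq
      simp only [update_self]
      split_ifs at ih ⊢ <;> omega
    by_cases hip : i = p
    · subst hip
      simp only [update_of_ne hpq, update_self]
      split_ifs at ih ⊢ <;> omega
    · simp only [update_of_ne hip, update_of_ne hiq]
      split_ifs at ih ⊢ <;> omega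

/-- If `M` majorizes `L` and they differ, one unit can be moved within `M` from a position `p` to a
later position `q` without destroying majorization: take for `p` the first difference and for
`q + 1` the next index with equal partial sums. Only `L` has to be monotone. -/
lemma exists_transfer {L M : ℕ → ℕ} {N : ℕ} (hL : Antitone L)
    (hle : ∀ i, ∑ k ∈ Finset.range i, L k ≤ ∑ k ∈ Finset.range i, M k)
    (htot : ∑ k ∈ Finset.range N, L k = ∑ k ∈ Finset.range N, M k)
    (hne : ∃ k < N, L k ≠ M k) :
    ∃ p q, p < q ∧ q < N ∧ M q + 2 ≤ M p ∧ ∀ i, p < i → i ≤ q →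
      ∑ k ∈ Finset.range i, L k < ∑ k ∈ Finset.range i, M k := by
  classical
  set p := Nat.find hne with hpdef
  obtain ⟨hpN, hpne⟩ := Nat.find_spec hne
  rw [← hpdef] at hpN hpne
  have hmin : ∀ k < p, L k = M k := by
    intro k hk
    by_contra h
    exact Nat.find_min hne hk ⟨hk.trans hpN, h⟩
  have hsum : ∑ k ∈ Finset.range p, L k = ∑ k ∈ Finset.range p, M k :=
    Finset.sum_congr rfl fun k hk => hmin k (Finset.mem_range.1 hk)
  have hp1 := hle (p + 1)
  rw [Finset.sum_range_succ, Finset.sum_range_succ, hsum] at hp1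
  have hex : ∃ r, p < r ∧ ∑ k ∈ Finset.range r, L k = ∑ k ∈ Finset.range r, M k :=
    ⟨N, hpN, htot⟩
  obtain ⟨hpr, hreq⟩ := Nat.find_spec hex
  have hrmin := fun {m} => Nat.find_min (m := m) hex
  have hrN : Nat.find hex ≤ N := Nat.find_min' hex ⟨hpN, htot⟩
  generalize Nat.find hex = r at hpr hreq hrmin hrN
  obtain ⟨q, rfl⟩ : ∃ q, r = q + 1 := ⟨r - 1, by omega⟩
  have hlt : ∀ i, p < i → i ≤ q → ∑ k ∈ Finset.range i, L k < ∑ k ∈ Finset.range i, M k := by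
    intro i hi hiq
    exact lt_of_le_of_ne (hle i) fun h => hrmin (Nat.lt_succ_of_le hiq) ⟨hi, h⟩
  have hpq : p < q := by
    rcases Nat.lt_or_ge p q with h | h
    · exact h
    · obtain rfl : p = q := by omega
      rw [Finset.sum_range_succ, Finset.sum_range_succ, hsum] at hreq
      omega
  refine ⟨p, q, hpq, hrN, ?_, hlt⟩
  have h1 := hlt q hpq le_rfl
  rw [Finset.sum_range_succ, Finset.sum_range_succ] at hreq
  have h2 := hL hpq.le
  omega

/-- If `M` majorizes the antitone sequence `L`, transfers carry `M` to `L`. Each of them lowers the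
sum of the partial sums of `M`, on which the induction runs. -/
theorem TotallyNonneg.weightedMinorSum_le_of_majorized {A : Matrix (Fin n) (Fin n) ℝ}
    (hA : TotallyNonneg A) {L : ℕ → ℕ} (N : ℕ) (hL : Antitone L) :
    ∀ M : ℕ → ℕ, (∀ i, ∑ k ∈ Finset.range i, L k ≤ ∑ k ∈ Finset.range i, M k) →
      ∑ k ∈ Finset.range N, L k = ∑ k ∈ Finset.range N, M k →
      weightedMinorSum A (fun k : Fin N => M k) ≤ weightedMinorSum A (fun k : Fin N => L k) := by
  intro M
  induction hS : ∑ i ∈ Finset.range N, ∑ k ∈ Finset.range i, M k using Nat.strong_induction_on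
    generalizing M with
  | _ S ih =>
  intro hle htot
  by_cases hne : ∃ k < N, L k ≠ M k
  swap
  · push Not at hne
    rw [show (fun k : Fin N => M k) = fun k : Fin N => L k from
      funext fun k => (hne k k.2).symm]
  obtain ⟨p, q, hpq, hqN, hpq2, hlt⟩ := exists_transfer hL hle htot hne
  set M' := update (update M p (M p - 1)) q (M q + 1) with hM'
  have hsum := sum_range_transfer (M := M) hpq.ne (by omega)
  rw [← hM'] at hsum
  have hle' : ∀ i, ∑ k ∈ Finset.range i, M' k ≤ ∑ k ∈ Finset.range i, M k := by
    intro i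
    have := hsum i
    split_ifs at this <;> omega
  have hstep := hA.weightedMinorSum_le_transfer (ι := Fin N) (a := ⟨p, hpq.trans hqN⟩)
    (b := ⟨q, hqN⟩) (by simp [hpq.ne]) (l := fun k => M k) hpq2
  have hfun : (fun k : Fin N => M' k) = update (update (fun k : Fin N => M k)
      ⟨p, hpq.trans hqN⟩ (M p - 1)) ⟨q, hqN⟩ (M q + 1) := by
    funext k
    simp only [hM', update_apply, Fin.ext_iff]
  rw [← hfun] at hstep
  refine hstep.trans (ih _ ?_ M' rfl (fun i => ?_) ?_)
  · rw [← hS]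
    refine Finset.sum_lt_sum (fun i _ => hle' i) ⟨q, Finset.mem_range.2 hqN, ?_⟩
    have := hsum q
    rw [if_pos hpq, if_neg (lt_irrefl q)] at this
    omega
  · have h1 := hsum i
    have h2 := hle i
    have h3 := hlt i
    split_ifs at h1 with h4 h5 h5
    · omega
    · have := h3 h4 (by omega); omega
    · omega
    · omega
  · have := hsum N
    rw [if_pos (hpq.trans hqN), if_pos hqN] at this
    omega

end

/-! ### Partitions as lists of block sizes -/

section

lemma sum_take_eq_sum_range (l : List ℕ) (i : ℕ) :
    (l.take i).sum = ∑ k ∈ Finset.range i, l.getD k 0 := by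
  induction l generalizing i with
  | nil => simp
  | cons a l ih =>
    cases i with
    | zero => simp
    | succ i => simp [Finset.sum_range_succ', ih, add_comm]

lemma prod_map_eq_prod_range {l : List ℕ} {f : ℕ → ℕ} (hf : f 0 = 1) {N : ℕ}
    (hN : l.length ≤ N) : (l.map f).prod = ∏ k ∈ Finset.range N, f (l.getD k 0) := by
  induction l generalizing N with
  | nil => simp [hf]
  | cons a l ih =>
    obtain ⟨N, rfl⟩ : ∃ N', N = N' + 1 := ⟨N - 1, by simp at hN; omega⟩
    rw [Finset.prod_range_succ', List.map_cons, List.prod_cons,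
      ih (N := N) (by simpa using hN), mul_comm]
    simp

lemma antitone_getD {l : List ℕ} (hl : l.Pairwise (· ≥ ·)) : Antitone fun k => l.getD k 0 := by
  intro i j hij
  rcases hij.eq_or_lt with rfl | hij
  · exact le_rfl
  by_cases hj : j < l.length
  · simp only [List.getD_eq_getElem _ _ hj, List.getD_eq_getElem _ _ (hij.trans hj)]
    exact List.pairwise_iff_getElem.1 hl i j (hij.trans hj) hj hij
  · simp [hj]

/-- Padding a list of sizes with zeros only adds empty sets to the families. -/
lemma sum_orderedSetPartitions {n : ℕ} (g : Finset (Fin n) → ℝ) (hg : g ∅ = 1) {l : List ℕ}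
    {N : ℕ} (hN : l.length ≤ N) :
    ∑ I ∈ orderedSetPartitions n l, ∏ k, g (I k) =
      ∑ I ∈ disjointFamilies n (fun k : Fin N => l.getD k 0), ∏ k, g (I k) := by
  refine Finset.sum_bij'
    (fun I _ => fun k : Fin N => if h : k.val < l.length then I ⟨k, h⟩ else ∅)
    (fun I _ => fun k => I (Fin.castLE hN k)) ?_ ?_ ?_ ?_ ?_
  · intro I hI
    simp only [orderedSetPartitions, Finset.mem_filter, Finset.mem_univ, true_and] at hI
    rw [mem_disjointFamilies]
    refine ⟨fun k => ?_, fun j k hjk => ?_⟩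
    · by_cases h : k.val < l.length
      · simp [h, hI.1]
      · simp [h]
    · by_cases h : j.val < l.length
      · by_cases h' : k.val < l.length
        · simp only [h, h', dif_pos]
          exact hI.2 _ _ fun e => hjk (Fin.ext (by simpa using e))
        · simp [h']
      · simp [h]
  · intro I hI
    rw [mem_disjointFamilies] at hI
    simp only [orderedSetPartitions, Finset.mem_filter, Finset.mem_univ, true_and]
    exact ⟨fun k => by simp [hI.1],
      fun j k hjk => hI.2 _ _ fun e => hjk (Fin.castLE_injective hN e)⟩
  · intro I _
    funext k
    simp
  · intro I hI
    rw [mem_disjointFamilies] at hI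
    funext k
    by_cases h : k.val < l.length
    · simp [h]
    · have : I k = ∅ := by rw [← Finset.card_eq_zero, hI.1]; simp [h]
      simp [h, this]
  · intro I _
    have h0 : ∀ k : Fin N, k ∉ Set.range (Fin.castLE hN) →
        g (if h : k.val < l.length then I ⟨k, h⟩ else ∅) = 1 := by
      intro k hk
      rw [dif_neg, hg]
      exact fun h => hk ⟨⟨k, h⟩, rfl⟩
    refine Fintype.prod_of_injective _ (Fin.castLE_injective hN) _ _ h0 fun k => ?_
    simp

lemma principalMinor_empty {n : ℕ} (A : Matrix (Fin n) (Fin n) ℝ) : principalMinor A ∅ = 1 :=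
  Matrix.det_isEmpty

lemma factorialProduct_mul_minorProductSum {n : ℕ} (A : Matrix (Fin n) (Fin n) ℝ)
    (p : n.Partition) {N : ℕ} (hN : (partSeq p).length ≤ N) :
    (factorialProduct p : ℝ) * minorProductSum A p =
      weightedMinorSum A (fun k : Fin N => (partSeq p).getD k 0) := by
  rw [factorialProduct, minorProductSum, weightedMinorSum,
    prod_map_eq_prod_range Nat.factorial_zero hN,
    sum_orderedSetPartitions _ (principalMinor_empty A) hN,
    Finset.prod_range fun k => ((partSeq p).getD k 0).factorial]

lemma sum_range_partSeq {n : ℕ} (p : n.Partition) {N : ℕ} (hN : (partSeq p).length ≤ N) :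
    ∑ k ∈ Finset.range N, (partSeq p).getD k 0 = n := by
  rw [← sum_take_eq_sum_range, List.take_of_length_le hN, partSeq, ← Multiset.sum_coe,
    Multiset.sort_eq, p.parts_sum]

end

end BarrettJohnson

theorem theorem5p2 (n : ℕ) (hn : 0 < n) (lam mu : n.Partition)
    (hmaj : BarrettJohnson.MajorizedBy lam mu)
    (A : Matrix (Fin n) (Fin n) ℝ) (hA : BarrettJohnson.TotallyNonneg A) :
    (BarrettJohnson.factorialProduct lam : ℝ) * BarrettJohnson.minorProductSum A lam ≥
      (BarrettJohnson.factorialProduct mu : ℝ) * BarrettJohnson.minorProductSum A mu := by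
  open BarrettJohnson in
  set N := max (partSeq lam).length (partSeq mu).length
  have hlam : (partSeq lam).length ≤ N := le_max_left _ _
  have hmu : (partSeq mu).length ≤ N := le_max_right _ _
  rw [ge_iff_le, factorialProduct_mul_minorProductSum A lam hlam,
    factorialProduct_mul_minorProductSum A mu hmu]
  refine hA.weightedMinorSum_le_of_majorized N (L := fun k => (partSeq lam).getD k 0)
    (antitone_getD (lam.parts.pairwise_sort _)) (fun k => (partSeq mu).getD k 0)
    (fun i => ?_) ?_
  · rw [← sum_take_eq_sum_range, ← sum_take_eq_sum_range]
    exact hmaj i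
  · rw [sum_range_partSeq lam hlam, sum_range_partSeq mu hmu]
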